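/- **Setting.** Let $0<\eta<1$, $\tfrac12<p<p_c:=1-\tfrac{\eta}{2}$, $q:=1-p$, $\gamma>0$, $\Delta>0$. Let $\theta^*\in[-\beta_\Theta,\beta_\Theta]$ with $\beta_\Theta>0$. Let $d$ be a distance on $\mathbb R$ such that, for every $t$, $-d(\cdot,t)$ is strictly increasing on $(-\infty,t]$ and strictly decreasing on $[t,\infty)$, and put $u(\theta)=-d(\theta,\theta^*)$. For $\theta\in[-\beta_\Theta,\beta_\Theta]$ let $c^-(\theta)<\theta<c^+(\theta)$ be points with $d(c^\pm(\theta),\theta)=\Delta/2$. Let $\mu_0$ be a prior on $[-\beta_\Theta,\beta_\Theta]$ with a density $\rho_0$ that is positive everywhere. *Horizontal moves.* Let $\theta_k$ be the median of the current density $\rho_k$. A human repeatedly compares $c^-(\theta_k)$ with $c^+(\theta_k)$; the $i$-th answer $\tilde Z_{k,i}$ is $+1$ if $u(c^+(\theta_k))+\xi^+_{k,i}>u(c^-(\theta_k))+\xi^-_{k,i}$ and $-1$ otherwise, where all $\xi^\pm_{k,i}$ are independent with distribution function $x\mapsto\exp(-e^{-x/\gamma})$. The comparisons stop at the first $m\ge1$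 with $|S_m|\ge\sqrt{2m(\ln(m+1)-\ln\eta)}$, where $S_m$ is the sum of the first $m$ answers, and $Z_k\in\{+1,-1\}$ is then the sign of $S_m$. If $Z_k=+1$, then $\rho_{k+1}=2p\rho_k$ on $[\theta_k,\infty)$ and $2q\rho_k$ on $(-\infty,\theta_k)$; if $Z_k=-1$, then $p$ and $q$ are exchanged. If the comparisons at $\theta_k$ never stop (which has probability zero unless $\theta_k=\theta^*$), no further move is made and $\theta_j=\theta_k$ for all $j\ge k$. *Prior assumption at radius $a$, with exponent $\varsigma\in(0,1]$:* $\mu_0((\theta^*-a,\theta^*])\ge a^\varsigma$ if $a<\theta^*+\beta_\Theta$, and $\mu_0([\theta^*,\theta^*+a))\ge a^\varsigma$ if $a<\beta_\Theta-\theta^*$. For $w,t>0$ put $$\tau_{w,t}(\delta,\varepsilon)=\max\left\{\frac{4w\log\frac{8t}{\delta\varepsilon^{\varsigma}}}{r_2\alpha},\ \frac{2\log(8\beta_2/\delta)}{r_1},\ \frac{\log(8\beta_2/\delta)}{r_R}\right\}.$$ **Theorem (Sample complexity of horizontal moves).** 1. There are constants $r_1,r_2,\alpha,r_R,\beta_2,C>0$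 depending only on $p,\eta,\gamma,\Delta$ such that for every $\varsigma\in(0,1]$, with $\tau^{\to}=\tau_{w,1}$ and $w=\max\{1,\varsigma(1+\varsigma)\}$: for all $\theta^*,\beta_\Theta,d,c^\pm,\mu_0$ as above, all $\delta\in(0,1)$ and all $\varepsilon>0$ for which the prior assumption holds at radius $a=\varepsilon$, $$\Pr(|\theta_k-\theta^*|\le\varepsilon)>1-\delta\qquad\text{for all integers }k\ge\tau^{\to}(\delta,\varepsilon),$$ and $\tau^{\to}(\delta,\varepsilon)\le C\log\frac{1}{\delta\varepsilon^{\varsigma}}$ for all $\delta\in(0,\tfrac12]$, $\varepsilon\in(0,1]$. 2. If $\theta^*>0$, the same two conclusions hold with $$\tau^{\to}(\delta,\varepsilon)=\tau_{\varsigma(1+\varsigma),\theta^*}(\delta,\varepsilon)=\max\left\{\frac{4\varsigma(1+\varsigma)\log\frac{8\theta^*}{\delta\varepsilon^{\varsigma}}}{r_2\alpha},\ \frac{2\log(8\beta_2/\delta)}{r_1},\ \frac{\log(8\beta_2/\delta)}{r_R}\right\},$$ where $r_1,r_2,r_R>0$ depend only on $p,\eta,\gamma,\Delta$, where $\alpha>0$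 may depend in addition on $\varsigma$, and where $\beta_2,C>0$ may depend in addition on $\varsigma$ and $\theta^*$ (but none on $\beta_\Theta,d,c^\pm,\mu_0,\delta,\varepsilon,k$). -/

import Mathlib

open MeasureTheory ProbabilityTheory

namespace MAPB

/-- `d` is a distance on the line such that, for every target `t`, the utility `x ↦ -d x t` is
unimodal: strictly increasing to the left of `t` and strictly decreasing to the right of `t`. -/
structure IsUnimodalDistance (d : ℝ → ℝ → ℝ) : Prop where
  eq_zero_iff : ∀ x y, d x y = 0 ↔ x = y
  symm : ∀ x y, d x y = d y x
  triangle : ∀ x y z, d x z ≤ d x y + d y z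
  lt_of_left : ∀ x y t, x < y → y ≤ t → d y t < d x t
  lt_of_right : ∀ x y t, t ≤ x → x < y → d x t < d y t

/-- The one-dimensional alignment problem with comparison granularity `Δ` and true parameter `θs`:
a parameter interval `[-bound, bound]`, a distance, for each query point `θ` the two points
`cMinus θ < θ < cPlus θ` at distance `Δ / 2` from `θ` which the human compares, and a prior
probability density that is positive on `[-bound, bound]`. (That the integral is `1` includes the
integrability of the density.) -/
structure AlignmentModel (Δ θs : ℝ) where
  bound : ℝ
  bound_pos : 0 < bound
  mem_range : θs ∈ Set.Icc (-bound) bound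
  dist : ℝ → ℝ → ℝ
  dist_spec : IsUnimodalDistance dist
  cMinus : ℝ → ℝ
  cPlus : ℝ → ℝ
  cMinus_lt : ∀ θ ∈ Set.Icc (-bound) bound, cMinus θ < θ
  lt_cPlus : ∀ θ ∈ Set.Icc (-bound) bound, θ < cPlus θ
  dist_cMinus : ∀ θ ∈ Set.Icc (-bound) bound, dist (cMinus θ) θ = Δ / 2
  dist_cPlus : ∀ θ ∈ Set.Icc (-bound) bound, dist (cPlus θ) θ = Δ / 2
  prior : ℝ → ℝ
  prior_pos : ∀ x ∈ Set.Icc (-bound) bound, 0 < prior x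
  integral_prior : ∫ x in (-bound)..bound, prior x = 1

/-- The noise of the random utility model: `ξ k i true` and `ξ k i false` perturb the utilities of
the upper and of the lower point in the `i`-th comparison at the `k`-th query point. All of them are
independent with the Gumbel distribution of scale `γ`. -/
structure IsGumbelNoise {Ω : Type*} [MeasurableSpace Ω] (P : Measure Ω) (γ : ℝ)
    (ξ : ℕ → ℕ → Bool → Ω → ℝ) : Prop where
  measurable : ∀ k i b, Measurable (ξ k i b)
  cdf_eq : ∀ k i b x, P.real {ω | ξ k i b ω ≤ x} = Real.exp (-Real.exp (-x / γ))
  indep : iIndepFun (fun j : ℕ × ℕ × Bool => ξ j.1 j.2.1 j.2.2) P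

/-- The partial sums `S_m` of a sequence of signs. -/
def walk (z : ℕ → ℝ) (m : ℕ) : ℝ := ∑ i ∈ Finset.range m, z i

/-- The boundary `(2 m (ln (m + 1) - ln η)) ^ (1 / 2)` of the power-one test. -/
noncomputable def boundary (η : ℝ) (m : ℕ) : ℝ :=
  Real.sqrt (2 * m * (Real.log (m + 1) - Real.log η))

open Classical in
/-- The outcome of the power-one test: the sign of the walk at the first `m ≥ 1` with
`|S_m| ≥ boundary η m`, and `0` if the test never stops. -/
noncomputable def testOutcome (η : ℝ) (z : ℕ → ℝ) : SignType :=
  if h : ∃ m : ℕ, 1 ≤ m ∧ boundary η m ≤ |walk z m| then SignType.sign (walk z (Nat.find h)) else 0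

/-- The median of a probability density `ρ` on `[-b, b]`. -/
noncomputable def median (b : ℝ) (ρ : ℝ → ℝ) : ℝ :=
  sInf {x ∈ Set.Icc (-b) b | 1 / 2 ≤ ∫ t in (-b)..x, ρ t}

/-- The current posterior density, and whether all the tests so far have stopped. -/
structure State where
  density : ℝ → ℝ
  running : Bool

open Classical in
/-- One horizontal move from the query point `θ` with signal `z`. The signal `z = 0` stands for a
test that never stops; no further move is made then. -/
noncomputable def State.move (p : ℝ) (s : State) (θ : ℝ) (z : SignType) : State :=
  if s.running = false ∨ z = 0 then ⟨s.density, false⟩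
  else if z = 1 then
    ⟨fun x => if θ ≤ x then 2 * p * s.density x else 2 * (1 - p) * s.density x, true⟩
  else
    ⟨fun x => if θ ≤ x then 2 * (1 - p) * s.density x else 2 * p * s.density x, true⟩

namespace AlignmentModel

variable {Δ θs : ℝ} (M : AlignmentModel Δ θs)

/-- The utility, the negative distance to the true parameter. -/
def utility (θ : ℝ) : ℝ := -M.dist θ θs

/-- The answer of the human at the query point `θ`: `1` if the upper point has the larger noisy
utility, `-1` otherwise. -/
noncomputable def answer (θ noisePlus noiseMinus : ℝ) : ℝ :=
  if M.utility (M.cMinus θ) + noiseMinus < M.utility (M.cPlus θ) + noisePlus then 1 else -1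

/-- The state after `k` horizontal moves. The query point is the median of the current density, and
the signal is the outcome of the power-one test applied to the human answers there. -/
noncomputable def state {Ω : Type*} (p η : ℝ) (ξ : ℕ → ℕ → Bool → Ω → ℝ) (ω : Ω) : ℕ → State
  | 0 => ⟨M.prior, true⟩
  | k + 1 =>
    (state p η ξ ω k).move p (median M.bound (state p η ξ ω k).density)
      (testOutcome η fun i =>
        M.answer (median M.bound (state p η ξ ω k).density) (ξ k i true ω) (ξ k i false ω))

/-- The query point `θ_k`. If a test never stops, the query point stays where it is. -/
noncomputable def query {Ω : Type*} (p η : ℝ) (ξ : ℕ → ℕ → Bool → Ω → ℝ) (k : ℕ) (ω : Ω) : ℝ :=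
  median M.bound (M.state p η ξ ω k).density

/-- The prior assumption at radius `a`: the interval of length `a` on each side of `θs` has prior
mass at least `a ^ ς`, for each side on which the parameter range extends beyond that interval. -/
def PriorAssumption (ς a : ℝ) : Prop :=
  (a < θs + M.bound → a ^ ς ≤ ∫ x in (θs - a)..θs, M.prior x) ∧
  (a < M.bound - θs → a ^ ς ≤ ∫ x in θs..(θs + a), M.prior x)

/-- With human comparisons under Gumbel noise of scale `γ`, after at least `τ` horizontal moves the
query point is within `ε` of the true parameter with probability larger than `1 - δ`. -/
def ReachesPrecision (p η γ δ ε τ : ℝ) : Prop :=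
  ∀ (Ω : Type*) [MeasurableSpace Ω] (P : Measure Ω) [IsProbabilityMeasure P]
    (ξ : ℕ → ℕ → Bool → Ω → ℝ), IsGumbelNoise P γ ξ →
    ∀ k : ℕ, τ ≤ k → 1 - δ < P.real {ω | |M.query p η ξ k ω - θs| ≤ ε}

end AlignmentModel

/-- The number of horizontal moves
`max {4 w log (8 t / (δ ε ^ ς)) / (r₂ α), 2 log (8 β₂ / δ) / r₁, log (8 β₂ / δ) / r_R}`. -/
noncomputable def horizontalMoves (w t r₁ r₂ α rR β₂ ς δ ε : ℝ) : ℝ :=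
  max (4 * w * Real.log (8 * t / (δ * ε ^ ς)) / (r₂ * α))
    (max (2 * Real.log (8 * β₂ / δ) / r₁) (Real.log (8 * β₂ / δ) / rR))

end MAPB

/-!
The proof is a potential argument. Fix one side of the target `θs`, let `A` be the current mass
within `ε` of `θs` on that side, `B` the mass further away, and `R = A + B`. The ratio `min B (1 /
2) / A` does not change as long as the query point is on the other side. It is a supermartingale
when the query point is on this side, because a wrong signal has probability at most `η / 2 < 1 -
p`; but it need not decrease in the mean when the query point is close to `θs`, that is, when `R` is
close to `1 / 2`. From there, however, a wrong signal carries `R` beyond `p`, where the ratio does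
contract by a fixed factor, and wrong signals have probability at least some `κ > 0`: by the
triangle inequality the two compared utilities differ by at most `Δ`. While the query point is on
the other side, `R` grows and `1 / R` contracts in the mean. The factor `sideWeight p σ τ R = 1 + σ
/ R + τ 1_{R < p}` combines these effects: for small `τ` and much smaller `σ`, the product
`potential` contracts in the mean by a factor `l < 1` in every move
(`StepConstants.potentialOf_step`). It is at least `1` whenever the query point is further than `ε`
from `θs` on this side, and initially it is at most a constant times `ε ^ (-2 ς)`. Hence an error
after `k` moves has probability at most a constant times `l ^ k ε ^ (-2 ς)` (`exists_rate`), and the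
constants in the number of moves are read off from this bound.

The error probability of the power-one test is bounded on the probability space of the noise itself.
With the same noise, an indifferent human gives answers that are pointwise below those of a human
preferring the upper point, so a wrong outcome for the latter is also the outcome for the former
(`testOutcome_neg_one_of_le`). For the indifferent human the two outcomes have equal probability by
exchanging the noises of the two points, and together they have probability at most `η` by Ville's
inequality for the mixture of all coins against the fair coin (`measure_exists_crosses_le`): the
ratio is `2 ^ n / ((n + 1) * n.choose h)` after `n` answers with `h` positive ones, and by
Chernoff's bound it is at least `1 / η` on the boundary.

The points `cMinus θ` and `cPlus θ` need not depend measurably on `θ`. Since the query point is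
determined by the previous signals, all conditioning is on a random variable with countably many
values, the list of these signals, which is independent of the noise of the next test.
-/

namespace MAPB

/-! ### The potential of one side and its one-step contraction -/

/-- Weight of the mass `R` on the considered side of the target. The term `σ / R` makes the weight
decrease along the climb of `R` from small values up to `1 / 2`; the term `τ` is paid as long as
`R < p`, because only beyond `p` does the ratio of the far to the near mass contract by a fixed
factor. -/
noncomputable def sideWeight (p σ τ R : ℝ) : ℝ := 1 + σ / R + if R < p then τ else 0

/-- The potential of one side of the target: `A` is the mass near the target on that side and `B`
the mass further away. -/
noncomputable def potential (p σ τ A B : ℝ) : ℝ := min B (1 / 2) / A * sideWeight p σ τ (A + B)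

/-- Constants for which the expected potential contracts by the factor `l` in every step. Here `h`
bounds the probability of a wrong signal from above and `κ` the probability of either signal from
below; `l₁` bounds the factors by which the ratio of far to near mass (for query points on the
considered side beyond mass `p`) and the inverse mass of the side (for query points on the other
side) contract in the mean. -/
structure StepConstants (p h κ σ τ l₁ l : ℝ) : Prop where
  l₁_pos : 0 < l₁
  l₁_lt : l₁ < 1
  near : 1 - (p - 1 / 2) * (1 - ((1 - h) * ((1 - p) / p) + h * (p / (1 - p)))) ≤ l₁
  far : (1 - h) * (1 / (2 * p)) + h * (1 / (2 * (1 - p))) ≤ l₁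
  σ_pos : 0 < σ
  τ_pos : 0 < τ
  l_pos : 0 < l
  l_lt : l < 1
  climb : ∀ R, 0 < R → R ≤ 1 / 2 → 1 + τ + l₁ * (σ / R) ≤ l * (1 + τ + σ / R)
  drop : 1 + 2 * σ + (1 - κ) * (τ + σ / (1 - p) - 2 * σ) ≤ l * (1 + τ)
  contract : l₁ * (1 + σ / (1 - p) + τ) ≤ l

/-- The factor `(1 - h) q / p + h p / q` with `q = 1 - p` is below `1` because the probability `h`
of a wrong signal is below `q`, where the value is `q + p`. -/
lemma mean_ratio_lt_one {p h : ℝ} (hp : 1 / 2 < p) (hp1 : p < 1) (hh : h < 1 - p) :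
    (1 - h) * ((1 - p) / p) + h * (p / (1 - p)) < 1 := by
  have hq : 0 < 1 - p := by linarith
  have hp0 : 0 < p := by linarith
  have key : (1 - h) * ((1 - p) / p) + h * (p / (1 - p))
      = 1 - (1 - p - h) * (2 * p - 1) / (p * (1 - p)) := by
    field_simp
    ring
  rw [key]
  have : 0 < (1 - p - h) * (2 * p - 1) / (p * (1 - p)) :=
    div_pos (mul_pos (by linarith) (by linarith)) (mul_pos hp0 hq)
  linarith

/-- The mean of the inverses of the update factors `2 p` and `2 (1 - p)` is below `1` for the same
reason. -/
lemma mean_inverse_lt_one {p h : ℝ} (hp : 1 / 2 < p) (hp1 : p < 1) (hh : h < 1 - p) :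
    (1 - h) * (1 / (2 * p)) + h * (1 / (2 * (1 - p))) < 1 := by
  have hq : 0 < 1 - p := by linarith
  have hp0 : 0 < p := by linarith
  have key : (1 - h) * (1 / (2 * p)) + h * (1 / (2 * (1 - p)))
      = 1 - (1 - p - h) * (2 * p - 1) / (2 * (p * (1 - p))) := by
    field_simp
    ring
  rw [key]
  have : 0 < (1 - p - h) * (2 * p - 1) / (2 * (p * (1 - p))) :=
    div_pos (mul_pos (by linarith) (by linarith)) (by positivity)
  linarith

lemma exists_stepConstants {p h κ : ℝ} (hp : 1 / 2 < p) (hp1 : p < 1) (hh : h < 1 - p)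
    (hκ : 0 < κ) (hκ1 : κ ≤ 1) : ∃ σ τ l₁ l, StepConstants p h κ σ τ l₁ l := by
  have hq : 0 < 1 - p := by linarith
  have h0 := mean_ratio_lt_one hp hp1 hh
  have h2 := mean_inverse_lt_one hp hp1 hh
  set a₀ := (1 - h) * ((1 - p) / p) + h * (p / (1 - p)) with ha₀
  set a₂ := (1 - h) * (1 / (2 * p)) + h * (1 / (2 * (1 - p))) with ha₂
  set l₁ := max (1 / 2) (max (1 - (p - 1 / 2) * (1 - a₀)) a₂) with hl₁
  have l₁_lt : l₁ < 1 := by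
    refine max_lt (by norm_num) (max_lt ?_ h2)
    have : 0 < (p - 1 / 2) * (1 - a₀) := mul_pos (by linarith) (by linarith)
    linarith
  have l₁_pos : 0 < l₁ := lt_of_lt_of_le (by norm_num) (le_max_left _ _)
  set τ := (1 - l₁) / 2 with hτ
  have τ_pos : 0 < τ := by rw [hτ]; linarith
  set σ := κ * τ / (2 * (2 + 1 / (1 - p))) with hσ
  have hD : 0 < 2 + 1 / (1 - p) := by positivity
  have σ_pos : 0 < σ := by positivity
  have hσeq : 2 * σ + σ / (1 - p) = κ * τ / 2 := by
    rw [hσ]; field_simp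
  have hσq : σ / (1 - p) ≤ τ := by nlinarith
  set la := 1 - (1 - l₁) * (2 * σ) / (1 + τ + 2 * σ) with hla
  set lb := 1 - κ * τ / 2 / (1 + τ) with hlb
  set lc := l₁ * (2 - l₁) with hlc
  have hσq0 : 0 < σ / (1 - p) := by positivity
  refine ⟨σ, τ, l₁, max la (max lb lc), l₁_pos, l₁_lt,
    (le_max_left _ _).trans (le_max_right _ _), (le_max_right _ _).trans (le_max_right _ _),
    σ_pos, τ_pos, ?_, ?_, ?_, ?_, ?_⟩
  · exact lt_of_lt_of_le (mul_pos l₁_pos (by linarith))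
      ((le_max_right _ _).trans (le_max_right _ _))
  · refine max_lt ?_ (max_lt ?_ ?_)
    · have : 0 < (1 - l₁) * (2 * σ) / (1 + τ + 2 * σ) :=
        div_pos (mul_pos (by linarith) (by linarith)) (by linarith)
      linarith
    · have : 0 < κ * τ / 2 / (1 + τ) := by positivity
      linarith
    · nlinarith [sq_nonneg (1 - l₁), mul_pos (sub_pos.2 l₁_lt) (sub_pos.2 l₁_lt)]
  · intro R hR hR'
    have hx : 2 * σ ≤ σ / R := by
      rw [le_div_iff₀ hR]; nlinarith
    set x := σ / R
    have h1 : (1 - la) * (1 + τ + x) ≤ (1 - l₁) * x := by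
      have : (1 - la) = (1 - l₁) * (2 * σ) / (1 + τ + 2 * σ) := by rw [hla]; ring
      rw [this, div_mul_eq_mul_div, div_le_iff₀ (by linarith)]
      have : 0 ≤ (1 - l₁) * ((1 + τ) * (x - 2 * σ)) :=
        mul_nonneg (by linarith) (mul_nonneg (by linarith) (by linarith))
      nlinarith
    have h2 : la * (1 + τ + x) ≤ max la (max lb lc) * (1 + τ + x) :=
      mul_le_mul_of_nonneg_right (le_max_left _ _) (by linarith)
    linarith
  · have h1 : lb * (1 + τ) = 1 + τ - κ * τ / 2 := by
      rw [hlb]; field_simp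
    have h2 : lb * (1 + τ) ≤ max la (max lb lc) * (1 + τ) :=
      mul_le_mul_of_nonneg_right ((le_max_left _ _).trans (le_max_right _ _)) (by linarith)
    have h3 : 0 ≤ κ * (σ / (1 - p) - 2 * σ) := by
      refine mul_nonneg hκ.le ?_
      have : 2 * σ ≤ σ / (1 - p) := by rw [le_div_iff₀ hq]; nlinarith
      linarith
    nlinarith
  · refine le_trans ?_ ((le_max_right lb lc).trans (le_max_right _ _))
    rw [hlc]
    refine mul_le_mul_of_nonneg_left ?_ l₁_pos.le
    linarith

namespace StepConstants

variable {p h κ σ τ l₁ l : ℝ}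

lemma sideWeight_le (hc : StepConstants p h κ σ τ l₁ l) {r R : ℝ} (hr : 0 < r) (hR : r ≤ R) :
    sideWeight p σ τ R ≤ 1 + σ / r + τ := by
  have h1 : σ / R ≤ σ / r := div_le_div_of_nonneg_left hc.σ_pos.le hr hR
  have h2 : (if R < p then τ else 0) ≤ τ := by
    split_ifs
    · exact le_rfl
    · exact hc.τ_pos.le
  unfold sideWeight
  linarith

lemma one_le_sideWeight (hc : StepConstants p h κ σ τ l₁ l) {R : ℝ} (hR : 0 < R) :
    1 ≤ sideWeight p σ τ R := by
  have h1 : 0 ≤ σ / R := div_nonneg hc.σ_pos.le hR.le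
  have h2 : 0 ≤ (if R < p then τ else 0) := by
    split_ifs
    · exact hc.τ_pos.le
    · exact le_rfl
  unfold sideWeight
  linarith

lemma sideWeight_le_of_le (hc : StepConstants p h κ σ τ l₁ l) (hp : 1 / 2 < p) {R : ℝ}
    (hR : p ≤ R) : sideWeight p σ τ R ≤ 1 + 2 * σ := by
  have h1 : σ / R ≤ 2 * σ := by
    rw [div_le_iff₀ (by linarith)]
    nlinarith [hc.σ_pos]
  unfold sideWeight
  rw [if_neg (not_lt.2 hR)]
  linarith

lemma potential_nonneg (hc : StepConstants p h κ σ τ l₁ l) {A B : ℝ} (hA : 0 < A) (hB : 0 ≤ B) :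
    0 ≤ potential p σ τ A B :=
  mul_nonneg (div_nonneg (le_min hB (by norm_num)) hA.le)
    (zero_le_one.trans (hc.one_le_sideWeight (by linarith)))

/-- Once the far mass is at least `1 / 2`, that is, once the median lies in the far part, the
potential is at least `1`. -/
lemma one_le_potential (hc : StepConstants p h κ σ τ l₁ l) {A B : ℝ} (hA : 0 < A)
    (hB : 1 / 2 ≤ B) (hAB : A + B ≤ 1) : 1 ≤ potential p σ τ A B := by
  have h1 : 1 ≤ min B (1 / 2) / A := by
    rw [min_eq_right hB, le_div_iff₀ hA]
    linarith
  have h2 := hc.one_le_sideWeight (R := A + B) (by linarith)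
  unfold potential
  nlinarith

lemma potential_le (hc : StepConstants p h κ σ τ l₁ l) (hp : 1 / 2 < p) (hp1 : p < 1)
    {e A B : ℝ} (he : 0 < e) (he1 : e ≤ 1) (hA : e ≤ A) (hB : 0 ≤ B) :
    potential p σ τ A B ≤ (1 + σ + τ) / e ^ 2 := by
  have h1 : min B (1 / 2) / A ≤ 1 / e :=
    div_le_div₀ zero_le_one ((min_le_right _ _).trans (by norm_num)) he hA
  have h2 : sideWeight p σ τ (A + B) ≤ (1 + σ + τ) / e := by
    refine (hc.sideWeight_le he (by linarith)).trans ?_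
    rw [le_div_iff₀ he]
    have : (1 + σ / e + τ) * e = e + σ + τ * e := by field_simp
    nlinarith [hc.τ_pos]
  have h3 := hc.one_le_sideWeight (R := A + B) (by linarith)
  calc potential p σ τ A B ≤ 1 / e * ((1 + σ + τ) / e) :=
        mul_le_mul h1 h2 (by linarith) (by positivity)
    _ = (1 + σ + τ) / e ^ 2 := by field_simp

/-- Contraction when the query point does not lie on the considered side: the ratio of far to near
mass does not change, and the inverse mass of the side contracts in the mean. -/
lemma potential_step_out (hc : StepConstants p h κ σ τ l₁ l) (hp : 1 / 2 < p) (hp1 : p < 1)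
    {A B u d : ℝ} (hA : 0 < A) (hB : 0 ≤ B) (hAB : A + B ≤ 1 / 2)
    (hd0 : 0 ≤ d) (hu0 : 0 ≤ u) (hud : u + d ≤ 1) (hd : d ≤ h) :
    u * potential p σ τ (2 * p * A) (2 * p * B)
      + d * potential p σ τ (2 * (1 - p) * A) (2 * (1 - p) * B) ≤ l * potential p σ τ A B := by
  have hq : 0 < 1 - p := by linarith
  have hσ := hc.σ_pos
  have hR : 0 < A + B := by linarith
  have hmin : ∀ c : ℝ, 0 < c → min (c * B) (1 / 2) / (c * A) ≤ B / A := fun c hc0 ↦ by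
    rw [← mul_div_mul_left B A hc0.ne']
    exact div_le_div_of_nonneg_right (min_le_left _ _) (by positivity)
  have hw : ∀ c : ℝ, 0 < c → sideWeight p σ τ (c * A + c * B) ≤ 1 + τ + σ / (A + B) * (1 / c) :=
    fun c hc0 ↦ by
      refine (hc.sideWeight_le (r := c * (A + B)) (by positivity) (by linarith)).trans_eq ?_
      field_simp
      ring
  have hstep : ∀ c : ℝ, 0 < c → potential p σ τ (c * A) (c * B)
      ≤ B / A * (1 + τ + σ / (A + B) * (1 / c)) := fun c hc0 ↦
    mul_le_mul (hmin c hc0) (hw c hc0)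
      (zero_le_one.trans (hc.one_le_sideWeight (by positivity))) (by positivity)
  have hV : potential p σ τ A B = B / A * (1 + τ + σ / (A + B)) := by
    unfold potential sideWeight
    rw [if_pos (by linarith), min_eq_left (by linarith)]
    ring
  have h1 := mul_le_mul_of_nonneg_left (hstep (2 * p) (by linarith)) hu0
  have h2 := mul_le_mul_of_nonneg_left (hstep (2 * (1 - p)) (by linarith)) hd0
  -- the worst case of the mean inverse factor is a wrong signal with probability `h`
  have hmean : u * (1 / (2 * p)) + d * (1 / (2 * (1 - p))) ≤ l₁ := by
    refine le_trans ?_ hc.far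
    have h3 : 1 / (2 * p) ≤ 1 / (2 * (1 - p)) :=
      one_div_le_one_div_of_le (by linarith) (by linarith)
    have h4 : 0 ≤ 1 / (2 * p) := by positivity
    nlinarith
  have hx : 0 < σ / (A + B) := by positivity
  have h5 := hc.climb (A + B) hR hAB
  have h6 : (u + d) * (1 + τ)
      + σ / (A + B) * (u * (1 / (2 * p)) + d * (1 / (2 * (1 - p))))
      ≤ l * (1 + τ + σ / (A + B)) := by
    nlinarith [hc.τ_pos]
  have h7 := mul_le_mul_of_nonneg_left h6 (div_nonneg hB hA.le)
  rw [hV]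
  linarith

/-- Contraction when the query point lies on the considered side. The numbers `φu` and `φd` bound
the factors by which the ratio `Φ` of far to near mass changes under a wrong and a correct
signal. -/
lemma potential_step_in (hc : StepConstants p h κ σ τ l₁ l) (hp : 1 / 2 < p) (hp1 : p < 1)
    {R Ru Rd Φ Φu Φd φu φd u d : ℝ} (hR : 1 / 2 ≤ R) (hRu : p ≤ Ru) (hRd : 1 - p ≤ Rd)
    (hΦ : 0 ≤ Φ) (hu0 : 0 ≤ u) (hd0 : 0 ≤ d) (hφu0 : 0 ≤ φu) (hφd0 : 0 ≤ φd)
    (hφd : φd ≤ 1) (hdκ : d ≤ 1 - κ) (hΦu : Φu ≤ Φ * φu) (hΦd : Φd ≤ Φ * φd)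
    (hsum : u * φu + d * φd ≤ 1) (hsum' : p ≤ R → u * φu + d * φd ≤ l₁) :
    u * (Φu * sideWeight p σ τ Ru) + d * (Φd * sideWeight p σ τ Rd)
      ≤ l * (Φ * sideWeight p σ τ R) := by
  have hq : 0 < 1 - p := by linarith
  have hσ := hc.σ_pos
  have hτ := hc.τ_pos
  have hl := hc.l_pos
  set gu := sideWeight p σ τ Ru
  set gd := sideWeight p σ τ Rd
  set G := 1 + σ / (1 - p) + τ with hG
  have hgu : gu ≤ 1 + 2 * σ := hc.sideWeight_le_of_le hp hRu
  have hgd : gd ≤ G := hc.sideWeight_le hq hRd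
  have hgu1 : 1 ≤ gu := hc.one_le_sideWeight (by linarith)
  have hgd1 : 1 ≤ gd := hc.one_le_sideWeight (by linarith)
  have h2σ : 2 * σ ≤ σ / (1 - p) := by rw [le_div_iff₀ hq]; nlinarith
  have hdφ : d * φd ≤ 1 - κ := by nlinarith
  have hufu : 0 ≤ u * φu := mul_nonneg hu0 hφu0
  have hdfd : 0 ≤ d * φd := mul_nonneg hd0 hφd0
  have key : u * φu * gu + d * φd * gd ≤ l * sideWeight p σ τ R := by
    have h1 : u * φu * gu ≤ u * φu * (1 + 2 * σ) := mul_le_mul_of_nonneg_left hgu hufu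
    have h2 : d * φd * gd ≤ d * φd * G := mul_le_mul_of_nonneg_left hgd hdfd
    rcases lt_or_ge R p with hRp | hRp
    · have h3 : 1 + τ ≤ sideWeight p σ τ R := by
        unfold sideWeight
        rw [if_pos hRp]
        have : 0 ≤ σ / R := by positivity
        linarith
      have h4 : d * φd * (G - (1 + 2 * σ)) ≤ (1 - κ) * (G - (1 + 2 * σ)) :=
        mul_le_mul_of_nonneg_right hdφ (by linarith)
      have h5 := hc.drop
      have h6 : (u * φu + d * φd) * (1 + 2 * σ) ≤ 1 * (1 + 2 * σ) :=
        mul_le_mul_of_nonneg_right hsum (by linarith)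
      have h7 := mul_le_mul_of_nonneg_left h3 hl.le
      have h8 : G - (1 + 2 * σ) = τ + σ / (1 - p) - 2 * σ := by rw [hG]; ring
      rw [h8] at h4
      have h9 : d * φd * G = d * φd * (1 + 2 * σ) + d * φd * (τ + σ / (1 - p) - 2 * σ) := by
        rw [← h8]; ring
      linarith
    · have h3 := hc.one_le_sideWeight (R := R) (by linarith)
      have h4 : (u * φu + d * φd) * G ≤ l₁ * G :=
        mul_le_mul_of_nonneg_right (hsum' hRp) (by linarith)
      have h5 := hc.contract
      have h6 : u * φu * (1 + 2 * σ) ≤ u * φu * G := mul_le_mul_of_nonneg_left (by linarith) hufu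
      nlinarith
  have h1 : u * (Φu * gu) ≤ Φ * (u * φu * gu) := by
    have := mul_le_mul_of_nonneg_right hΦu (by linarith : 0 ≤ gu)
    nlinarith
  have h2 : d * (Φd * gd) ≤ Φ * (d * φd * gd) := by
    have := mul_le_mul_of_nonneg_right hΦd (by linarith : 0 ≤ gd)
    nlinarith
  have h3 := mul_le_mul_of_nonneg_left key hΦ
  linarith

/-- Contraction when the query point lies in the near part, which it cuts into the mass `A₁`
between target and query point and the mass `A₂` beyond. -/
lemma potential_step_near (hc : StepConstants p h κ σ τ l₁ l) (hp : 1 / 2 < p) (hp1 : p < 1)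
    (hh : h < 1 - p) {A₁ A₂ B u d : ℝ} (hA₁ : 0 ≤ A₁) (hA₂ : 0 ≤ A₂) (hA : 0 < A₁ + A₂)
    (hB : 0 ≤ B) (hAB : A₂ + B = 1 / 2) (hle : A₁ + A₂ + B ≤ 1)
    (hu0 : 0 ≤ u) (hd0 : 0 ≤ d) (hud : u + d ≤ 1) (hu : u ≤ h) (hdκ : d ≤ 1 - κ) :
    u * potential p σ τ (2 * (1 - p) * A₁ + 2 * p * A₂) (2 * p * B)
      + d * potential p σ τ (2 * p * A₁ + 2 * (1 - p) * A₂) (2 * (1 - p) * B)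
      ≤ l * potential p σ τ (A₁ + A₂) B := by
  have hq : 0 < 1 - p := by linarith
  have hp0 : 0 < p := by linarith
  set A := A₁ + A₂ with hAdef
  set a := A₁ / A with ha
  have ha0 : 0 ≤ a := div_nonneg hA₁ hA.le
  have ha1 : a ≤ 1 := (div_le_one hA).2 (by linarith)
  have hA1a : A₁ = a * A := by rw [ha]; field_simp
  have hA2a : A₂ = (1 - a) * A := by rw [sub_mul, ← hA1a, hAdef]; ring
  have hr1 : 1 ≤ p / (1 - p) := by rw [le_div_iff₀ hq]; linarith
  have hr2 : (1 - p) / p ≤ 1 := by rw [div_le_one hp0]; linarith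
  have hr3 : 0 ≤ (1 - p) / p := by positivity
  -- chords of the convex functions `a ↦ p / (q a + p (1 - a))` and `a ↦ q / (p a + q (1 - a))`
  have hchord : ∀ r s : ℝ, 0 < r → 0 < s →
      min (2 * r * B) (1 / 2) / (2 * s * A₁ + 2 * r * A₂)
        ≤ min B (1 / 2) / A * (1 - a + a * (r / s)) := by
    intro r s hr hs
    have hB2 : min B (1 / 2) = B := min_eq_left (by linarith)
    have hpos : 0 < s * a + r * (1 - a) := by
      rcases ha0.eq_or_lt with h0 | h0
      · rw [← h0]; simpa using hr
      · have := mul_nonneg hr.le (sub_nonneg.2 ha1)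
        have := mul_pos hs h0
        linarith
    have hden : 2 * s * A₁ + 2 * r * A₂ = 2 * (A * (s * a + r * (1 - a))) := by
      rw [hA1a, hA2a]; ring
    rw [hB2, hden]
    have h1 : min (2 * r * B) (1 / 2) / (2 * (A * (s * a + r * (1 - a))))
        ≤ 2 * r * B / (2 * (A * (s * a + r * (1 - a)))) :=
      div_le_div_of_nonneg_right (min_le_left _ _) (by positivity)
    refine h1.trans ?_
    have h2 : 2 * r * B / (2 * (A * (s * a + r * (1 - a))))
        = B / A * (r / (s * a + r * (1 - a))) := by
      field_simp
    rw [h2]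
    refine mul_le_mul_of_nonneg_left ?_ (by positivity)
    rw [div_le_iff₀ hpos]
    have h3 : (1 - a + a * (r / s)) * (s * a + r * (1 - a)) - r
        = a * (1 - a) * (r - s) ^ 2 / s := by
      field_simp
      ring
    have h4 : 0 ≤ a * (1 - a) * (r - s) ^ 2 / s :=
      div_nonneg (mul_nonneg (mul_nonneg ha0 (by linarith)) (sq_nonneg _)) hs.le
    linarith
  have hlt := mean_ratio_lt_one hp hp1 hh
  set m := (1 - h) * ((1 - p) / p) + h * (p / (1 - p)) with hm
  have hsum : u * (1 - a + a * (p / (1 - p))) + d * (1 - a + a * ((1 - p) / p))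
      ≤ 1 - a * (1 - m) := by
    have h1 : u * (p / (1 - p)) + d * ((1 - p) / p) ≤ m := by rw [hm]; nlinarith
    have h2 := mul_le_mul_of_nonneg_left h1 ha0
    have h3 : (u + d) * (1 - a) ≤ 1 * (1 - a) := mul_le_mul_of_nonneg_right hud (by linarith)
    nlinarith
  refine hc.potential_step_in hp hp1 (φu := 1 - a + a * (p / (1 - p)))
    (φd := 1 - a + a * ((1 - p) / p)) ?_ ?_ ?_ ?_ hu0 hd0 ?_ ?_ ?_ hdκ ?_ ?_ ?_ ?_
  · linarith
  · nlinarith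
  · nlinarith
  · exact div_nonneg (le_min hB (by norm_num)) hA.le
  · nlinarith
  · nlinarith
  · nlinarith
  · exact hchord p (1 - p) hp0 hq
  · exact hchord (1 - p) p hq hp0
  · nlinarith
  · intro hR
    refine hsum.trans (le_trans ?_ hc.near)
    -- the mass `A₁` equals `R - 1 / 2`, and `A ≤ 1`
    have : p - 1 / 2 ≤ a := by
      have : A₁ ≤ a := by rw [ha, le_div_iff₀ hA]; nlinarith
      linarith
    have := mul_le_mul_of_nonneg_right this (by linarith : 0 ≤ 1 - m)
    linarith

/-- Contraction when the query point lies in the far part, which it cuts into the mass `B₁` before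
the query point and the mass `1 / 2` beyond. -/
lemma potential_step_far (hc : StepConstants p h κ σ τ l₁ l) (hp : 1 / 2 < p) (hp1 : p < 1)
    {A B₁ u d : ℝ} (hA : 0 < A) (hB₁ : 0 ≤ B₁)
    (hu0 : 0 ≤ u) (hd0 : 0 ≤ d) (hud : u + d ≤ 1) (hu : u ≤ h) (hdκ : d ≤ 1 - κ) :
    u * potential p σ τ (2 * (1 - p) * A) (2 * (1 - p) * B₁ + 2 * p * (1 / 2))
      + d * potential p σ τ (2 * p * A) (2 * p * B₁ + 2 * (1 - p) * (1 / 2))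
      ≤ l * potential p σ τ A (B₁ + 1 / 2) := by
  have hq : 0 < 1 - p := by linarith
  have hp0 : 0 < p := by linarith
  have hmin : min (B₁ + 1 / 2) (1 / 2) = 1 / 2 := min_eq_right (by linarith)
  have hfac : ∀ c B' : ℝ, 0 < c → min B' (1 / 2) / (2 * c * A)
      ≤ min (B₁ + 1 / 2) (1 / 2) / A * (1 / (2 * c)) := fun c B' hc0 ↦ by
    rw [hmin]
    refine (div_le_div_of_nonneg_right (min_le_right _ _) (by positivity)).trans_eq ?_
    field_simp
  have hsum : u * (1 / (2 * (1 - p))) + d * (1 / (2 * p)) ≤ l₁ := by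
    refine le_trans ?_ hc.far
    have h3 : 1 / (2 * p) ≤ 1 / (2 * (1 - p)) :=
      one_div_le_one_div_of_le (by linarith) (by linarith)
    have h4 : 0 ≤ 1 / (2 * p) := by positivity
    nlinarith
  refine hc.potential_step_in hp hp1 (φu := 1 / (2 * (1 - p)))
    (φd := 1 / (2 * p)) ?_ ?_ ?_ ?_ hu0 hd0 ?_ ?_ ?_ hdκ ?_ ?_ ?_ ?_
  · linarith
  · nlinarith
  · nlinarith
  · rw [hmin]; positivity
  · positivity
  · positivity
  · rw [div_le_one (by linarith)]; linarith
  · exact hfac _ _ hq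
  · exact hfac _ _ hp0
  · linarith [hc.l₁_lt]
  · exact fun _ ↦ hsum

end StepConstants

/-! ### Masses under one Bayesian move -/

/-- The mass that the density `ρ` on `[-b, b]` gives to `S`. -/
noncomputable def mass (b : ℝ) (ρ : ℝ → ℝ) (S : Set ℝ) : ℝ :=
  ∫ x in S, ρ x ∂(volume.restrict (Set.Icc (-b) b))

lemma mass_Iic {b : ℝ} {ρ : ℝ → ℝ} {x : ℝ} (hx : x ∈ Set.Icc (-b) b) :
    mass b ρ (Set.Iic x) = ∫ t in (-b)..x, ρ t := by
  unfold mass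
  rw [Measure.restrict_restrict measurableSet_Iic, intervalIntegral.integral_of_le hx.1,
    ← integral_Icc_eq_integral_Ioc]
  congr 2
  ext y
  simp only [Set.mem_inter_iff, Set.mem_Iic, Set.mem_Icc]
  constructor
  · rintro ⟨h1, h2, -⟩; exact ⟨h2, h1⟩
  · rintro ⟨h1, h2⟩; exact ⟨h2, h1, h2.trans hx.2⟩

lemma mass_Iio (b : ℝ) (ρ : ℝ → ℝ) (x : ℝ) : mass b ρ (Set.Iio x) = mass b ρ (Set.Iic x) :=
  setIntegral_congr_set (ae_restrict_of_ae Iio_ae_eq_Iic)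

/-- `ρ` is a probability density on `[-b, b]`. -/
structure IsDensity (b : ℝ) (ρ : ℝ → ℝ) : Prop where
  pos : 0 < b
  nonneg : ∀ x ∈ Set.Icc (-b) b, 0 ≤ ρ x
  integrable : Integrable ρ (volume.restrict (Set.Icc (-b) b))
  mass_univ : mass b ρ Set.univ = 1

namespace IsDensity

variable {b : ℝ} {ρ : ℝ → ℝ}

lemma mass_nonneg (hρ : IsDensity b ρ) (S : Set ℝ) : 0 ≤ mass b ρ S := by
  refine integral_nonneg_of_ae (ae_restrict_of_ae ?_)
  filter_upwards [ae_restrict_mem measurableSet_Icc] with x hx using hρ.nonneg x hx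

lemma mass_inter_add_diff (hρ : IsDensity b ρ) (S : Set ℝ) {T : Set ℝ} (hT : MeasurableSet T) :
    mass b ρ (S ∩ T) + mass b ρ (S \ T) = mass b ρ S :=
  integral_inter_add_sdiff hT hρ.integrable.integrableOn

lemma mass_mono (hρ : IsDensity b ρ) {S T : Set ℝ} (hS : MeasurableSet S) (hST : S ⊆ T) :
    mass b ρ S ≤ mass b ρ T := by
  have h1 := hρ.mass_inter_add_diff T hS
  rw [Set.inter_eq_right.2 hST] at h1
  linarith [hρ.mass_nonneg (T \ S)]

lemma mass_le_one (hρ : IsDensity b ρ) {S : Set ℝ} (hS : MeasurableSet S) : mass b ρ S ≤ 1 :=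
  (hρ.mass_mono hS (Set.subset_univ S)).trans_eq hρ.mass_univ

/-- The Bayesian update with weights `c` and `c'` on the two sides of `θ`. -/
lemma mass_update (hρ : IsDensity b ρ) (c c' θ : ℝ) {S : Set ℝ} (hS : MeasurableSet S) :
    mass b (fun x ↦ if θ ≤ x then c * ρ x else c' * ρ x) S
      = c * mass b ρ (S ∩ Set.Ici θ) + c' * mass b ρ (S \ Set.Ici θ) := by
  have hint : IntegrableOn (fun x ↦ if θ ≤ x then c * ρ x else c' * ρ x) S
      (volume.restrict (Set.Icc (-b) b)) :=
    (Integrable.piecewise (s := Set.Ici θ) measurableSet_Ici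
      (hρ.integrable.const_mul c).integrableOn
      (hρ.integrable.const_mul c').integrableOn).integrableOn
  unfold mass
  rw [← integral_inter_add_sdiff (measurableSet_Ici (a := θ)) hint, ← integral_const_mul,
    ← integral_const_mul]
  congr 1
  · exact setIntegral_congr_fun (hS.inter measurableSet_Ici) fun x hx ↦ if_pos hx.2
  · exact setIntegral_congr_fun (hS.diff measurableSet_Ici) fun x hx ↦ if_neg hx.2

lemma update (hρ : IsDensity b ρ) {c c' θ : ℝ} (hc : 0 ≤ c) (hc' : 0 ≤ c') (hcc : c + c' = 2)
    (hθ : mass b ρ (Set.Ici θ) = 1 / 2) :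
    IsDensity b (fun x ↦ if θ ≤ x then c * ρ x else c' * ρ x) where
  pos := hρ.pos
  nonneg x hx := by
    have := hρ.nonneg x hx
    split_ifs <;> positivity
  integrable := Integrable.piecewise (s := Set.Ici θ) measurableSet_Ici
      (hρ.integrable.const_mul c).integrableOn (hρ.integrable.const_mul c').integrableOn
  mass_univ := by
    have h1 := hρ.mass_inter_add_diff Set.univ (measurableSet_Ici (a := θ))
    rw [hρ.mass_update _ _ _ MeasurableSet.univ, Set.univ_inter] at *
    rw [hρ.mass_univ, hθ] at h1
    rw [hθ, show mass b ρ (Set.univ \ Set.Ici θ) = 1 / 2 by linarith]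
    linarith

lemma median_spec (hρ : IsDensity b ρ) :
    median b ρ ∈ Set.Icc (-b) b ∧ mass b ρ (Set.Iio (median b ρ)) = 1 / 2 ∧
      mass b ρ (Set.Ici (median b ρ)) = 1 / 2 := by
  have hb := hρ.pos
  set F : ℝ → ℝ := fun x ↦ ∫ t in (-b)..x, ρ t with hF
  have hcont : ContinuousOn F (Set.Icc (-b) b) := by
    have := intervalIntegral.continuousOn_primitive_interval (a := -b) (b := b) (f := ρ)
      (μ := volume) (by rw [Set.uIcc_of_le (by linarith)]; exact hρ.integrable)
    rwa [Set.uIcc_of_le (by linarith)] at this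
  have hFb : F b = 1 := by
    rw [hF]
    dsimp only
    rw [← mass_Iic ⟨by linarith, le_rfl⟩, ← hρ.mass_univ]
    unfold mass
    rw [Measure.restrict_restrict measurableSet_Iic, Measure.restrict_restrict MeasurableSet.univ]
    congr 2
    ext y
    simp only [Set.mem_inter_iff, Set.mem_Iic, Set.mem_Icc, Set.mem_univ, true_and]
    exact ⟨fun h ↦ h.2, fun h ↦ ⟨h.2, h⟩⟩
  have hF0 : F (-b) = 0 := intervalIntegral.integral_same
  set T : Set ℝ := {x ∈ Set.Icc (-b) b | 1 / 2 ≤ ∫ t in (-b)..x, ρ t} with hT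
  have hTeq : T = Set.Icc (-b) b ∩ F ⁻¹' Set.Ici (1 / 2) := rfl
  have hTclosed : IsClosed T := hTeq ▸ hcont.preimage_isClosed_of_isClosed isClosed_Icc isClosed_Ici
  have hTne : T.Nonempty := ⟨b, ⟨by linarith, le_rfl⟩, by change _ ≤ F b; rw [hFb]; norm_num⟩
  have hTbdd : BddBelow T := ⟨-b, fun x hx ↦ hx.1.1⟩
  have hmem : median b ρ ∈ T := hTclosed.csInf_mem hTne hTbdd
  have hhalf : F (median b ρ) = 1 / 2 := by
    refine le_antisymm ?_ hmem.2
    obtain ⟨y, hy, hyF⟩ : (1 / 2 : ℝ) ∈ F '' Set.Icc (-b) (median b ρ) :=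
      intermediate_value_Icc hmem.1.1 (hcont.mono (Set.Icc_subset_Icc_right hmem.1.2))
        ⟨by rw [hF0]; norm_num, hmem.2⟩
    have hyT : y ∈ T := ⟨⟨hy.1, hy.2.trans hmem.1.2⟩, hyF.ge⟩
    have : median b ρ ≤ y := csInf_le hTbdd hyT
    rw [le_antisymm this hy.2, hyF]
  have h1 : mass b ρ (Set.Iio (median b ρ)) = 1 / 2 := by
    rw [mass_Iio, mass_Iic hmem.1]
    exact hhalf
  refine ⟨hmem.1, h1, ?_⟩
  have h2 := hρ.mass_inter_add_diff Set.univ (measurableSet_Iio (a := median b ρ))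
  rw [Set.univ_inter, h1, hρ.mass_univ, ← Set.compl_eq_univ_sdiff, Set.compl_Iio] at h2
  linarith

end IsDensity

/-! ### The two sides of the target -/

/-- The signal `z` at the query point `θ` does not point away from the target `t`. -/
def PointsTo (t θ : ℝ) (z : SignType) : Prop := (z = 1 ∧ θ ≤ t) ∨ (z = -1 ∧ t ≤ θ)

/-- One of the two sides of the target `t`, split into a part near `t` and a part far from `t`.
`toward` is the signal that points from `t` into this side, and `beyond θ` is the half-line which
this signal makes more likely at the query point `θ`. -/
structure Side (t : ℝ) where
  near : Set ℝ
  far : Set ℝ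
  toward : SignType
  beyond : ℝ → Set ℝ
  near_meas : MeasurableSet near
  far_meas : MeasurableSet far
  disjoint : Disjoint near far
  toward_beyond : (toward = 1 ∧ beyond = Set.Ici) ∨ (toward = -1 ∧ beyond = Set.Iio)
  zones : ∀ θ, (PointsTo t θ toward ∧ near ⊆ beyond θ ∧ far ⊆ beyond θ) ∨
    (PointsTo t θ (-toward) ∧ far ⊆ beyond θ ∧ beyond θ ⊆ near ∪ far) ∨
    (PointsTo t θ (-toward) ∧ Disjoint near (beyond θ) ∧ beyond θ ⊆ near ∪ far)
  beyond_subset : ∀ θ ∈ far, beyond θ ⊆ far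
  target_notMem : t ∉ far

/-- The side above `t`, with near part `[t, t + ε)`. -/
def Side.above (t : ℝ) {ε : ℝ} (hε : 0 < ε) : Side t where
  near := Set.Ico t (t + ε)
  far := Set.Ici (t + ε)
  toward := 1
  beyond := Set.Ici
  near_meas := measurableSet_Ico
  far_meas := measurableSet_Ici
  disjoint := Set.disjoint_left.2 fun _ hx hx' ↦ not_le.2 hx.2 hx'
  toward_beyond := Or.inl ⟨rfl, rfl⟩
  zones θ := by
    rcases lt_or_ge θ t with h | h
    · exact Or.inl ⟨Or.inl ⟨rfl, h.le⟩, fun x hx ↦ h.le.trans hx.1,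
        Set.Ici_subset_Ici.2 (by linarith)⟩
    have hsub : Set.Ici θ ⊆ Set.Ico t (t + ε) ∪ Set.Ici (t + ε) := fun x hx ↦ by
      rcases lt_or_ge x (t + ε) with h' | h'
      · exact Or.inl ⟨h.trans hx, h'⟩
      · exact Or.inr h'
    rcases le_or_gt θ (t + ε) with h' | h'
    · exact Or.inr (Or.inl ⟨Or.inr ⟨rfl, h⟩, Set.Ici_subset_Ici.2 h', hsub⟩)
    · exact Or.inr (Or.inr ⟨Or.inr ⟨rfl, h⟩,
        Set.disjoint_left.2 fun x hx hx' ↦ not_le.2 (hx.2.trans h') hx', hsub⟩)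
  beyond_subset _ hθ := Set.Ici_subset_Ici.2 hθ
  target_notMem h := by
    rw [Set.mem_Ici] at h
    linarith

/-- The side below `t`, with near part `[t - ε, t)`. Half-open intervals are used so that the parts
fit the half-lines `Iio θ` without exceptional points. -/
def Side.below (t : ℝ) {ε : ℝ} (hε : 0 < ε) : Side t where
  near := Set.Ico (t - ε) t
  far := Set.Iio (t - ε)
  toward := -1
  beyond := Set.Iio
  near_meas := measurableSet_Ico
  far_meas := measurableSet_Iio
  disjoint := Set.disjoint_left.2 fun _ hx hx' ↦ not_lt.2 hx.1 hx'
  toward_beyond := Or.inr ⟨rfl, rfl⟩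
  zones θ := by
    rcases lt_or_ge t θ with h | h
    · exact Or.inl ⟨Or.inr ⟨rfl, h.le⟩, fun x hx ↦ hx.2.trans h,
        Set.Iio_subset_Iio (by linarith)⟩
    have hsub : Set.Iio θ ⊆ Set.Ico (t - ε) t ∪ Set.Iio (t - ε) := fun x hx ↦ by
      rcases lt_or_ge x (t - ε) with h' | h'
      · exact Or.inr h'
      · exact Or.inl ⟨h', lt_of_lt_of_le hx h⟩
    rcases le_or_gt (t - ε) θ with h' | h'
    · exact Or.inr (Or.inl ⟨Or.inl ⟨rfl, h⟩, Set.Iio_subset_Iio h', hsub⟩)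
    · exact Or.inr (Or.inr ⟨Or.inl ⟨rfl, h⟩,
        Set.disjoint_left.2 fun x hx hx' ↦ not_lt.2 (h'.le.trans hx.1) hx', hsub⟩)
  beyond_subset _ hθ := Set.Iio_subset_Iio hθ.le
  target_notMem h := by
    rw [Set.mem_Iio] at h
    linarith

namespace Side

variable {t : ℝ} (S : Side t)

lemma toward_ne_zero : S.toward ≠ 0 := by
  rcases S.toward_beyond with h | h <;> rw [h.1] <;> decide

lemma neg_toward_ne_zero : -S.toward ≠ 0 := by
  rcases S.toward_beyond with h | h <;> rw [h.1] <;> decide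

lemma beyond_meas (θ : ℝ) : MeasurableSet (S.beyond θ) := by
  rcases S.toward_beyond with h | h <;> rw [h.2]
  · exact measurableSet_Ici
  · exact measurableSet_Iio

/-- The potential of a density on the side `S`. -/
noncomputable def potentialOf (p σ τ b : ℝ) (ρ : ℝ → ℝ) : ℝ :=
  potential p σ τ (mass b ρ S.near) (mass b ρ S.far)

lemma mass_beyond_median {b : ℝ} {ρ : ℝ → ℝ} (hρ : IsDensity b ρ) :
    mass b ρ (S.beyond (median b ρ)) = 1 / 2 := by
  rcases S.toward_beyond with h | h <;> rw [h.2]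
  · exact hρ.median_spec.2.2
  · exact hρ.median_spec.2.1

lemma mass_near_add_far_le {b : ℝ} {ρ : ℝ → ℝ} (hρ : IsDensity b ρ) :
    mass b ρ S.near + mass b ρ S.far ≤ 1 := by
  have h := hρ.mass_inter_add_diff (S.near ∪ S.far) S.near_meas
  rw [Set.union_inter_cancel_left, Set.union_sdiff_left, S.disjoint.symm.sdiff_eq_left] at h
  rw [h]
  exact hρ.mass_le_one (S.near_meas.union S.far_meas)

end Side

lemma State.move_of_toward {t : ℝ} (S : Side t) {p b θ : ℝ} {s : State} (hs : s.running = true)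
    (hρ : IsDensity b s.density) (T : Set ℝ) (hT : MeasurableSet T) :
    mass b (s.move p θ S.toward).density T = 2 * p * mass b s.density (T ∩ S.beyond θ)
      + 2 * (1 - p) * mass b s.density (T \ S.beyond θ) := by
  have hIci : T \ Set.Iio θ = T ∩ Set.Ici θ := by
    rw [Set.sdiff_eq, Set.compl_Iio]
  have hIio : T \ Set.Ici θ = T ∩ Set.Iio θ := by
    rw [Set.sdiff_eq, Set.compl_Ici]
  rcases S.toward_beyond with ⟨h1, h2⟩ | ⟨h1, h2⟩ <;> rw [h1, h2] <;> unfold State.move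
  · rw [if_neg (by simp [hs]), if_pos rfl, hρ.mass_update _ _ _ hT]
  · rw [if_neg (by simp [hs]), if_neg (by decide), hρ.mass_update _ _ _ hT, hIci, hIio]
    ring

lemma State.move_of_neg_toward {t : ℝ} (S : Side t) {p b θ : ℝ} {s : State}
    (hs : s.running = true) (hρ : IsDensity b s.density) (T : Set ℝ) (hT : MeasurableSet T) :
    mass b (s.move p θ (-S.toward)).density T = 2 * (1 - p) * mass b s.density (T ∩ S.beyond θ)
      + 2 * p * mass b s.density (T \ S.beyond θ) := by
  have hIci : T \ Set.Iio θ = T ∩ Set.Ici θ := by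
    rw [Set.sdiff_eq, Set.compl_Iio]
  have hIio : T \ Set.Ici θ = T ∩ Set.Iio θ := by
    rw [Set.sdiff_eq, Set.compl_Ici]
  rcases S.toward_beyond with ⟨h1, h2⟩ | ⟨h1, h2⟩ <;> rw [h1, h2] <;> unfold State.move
  · rw [if_neg (by simp [hs]), if_neg (by decide), hρ.mass_update _ _ _ hT]
  · rw [if_neg (by simp [hs]), if_pos (by decide), hρ.mass_update _ _ _ hT, hIci, hIio]
    ring

lemma State.move_running {p θ : ℝ} {s : State} {z : SignType} (hs : s.running = true)
    (hz : z ≠ 0) : (s.move p θ z).running = true := by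
  unfold State.move
  rw [if_neg (by simp [hs, hz])]
  split_ifs <;> rfl

lemma State.move_stopped {p θ : ℝ} {s : State} {z : SignType} (h : s.running = false ∨ z = 0) :
    s.move p θ z = ⟨s.density, false⟩ := if_pos h

lemma State.isDensity_move {p b : ℝ} {s : State} (z : SignType) (hp0 : 0 < p) (hp1 : p < 1)
    (hρ : IsDensity b s.density) : IsDensity b (s.move p (median b s.density) z).density := by
  have hmed := hρ.median_spec.2.2
  unfold State.move
  split_ifs
  · exact hρ
  · exact hρ.update (by linarith) (by linarith) (by ring) hmed
  · exact hρ.update (by linarith) (by linarith) (by ring) hmed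

/-- The near mass stays positive, since a move multiplies the density by at least
`2 min p (1 - p)`. -/
lemma State.mass_near_move_pos {t : ℝ} (S : Side t) {p b θ : ℝ} {s : State} (z : SignType)
    (hp0 : 0 < p) (hp1 : p < 1) (hρ : IsDensity b s.density)
    (hpos : 0 < mass b s.density S.near) : 0 < mass b (s.move p θ z).density S.near := by
  by_cases h : s.running = false ∨ z = 0
  · rwa [State.move_stopped h]
  push Not at h
  have hs : s.running = true := by simpa using h.1
  have hadd := hρ.mass_inter_add_diff S.near (S.beyond_meas θ)
  have h1 := hρ.mass_nonneg (S.near ∩ S.beyond θ)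
  have h2 := hρ.mass_nonneg (S.near \ S.beyond θ)
  have key : ∀ c c' : ℝ, 0 < c → 0 < c' → 0 < 2 * c * mass b s.density (S.near ∩ S.beyond θ)
      + 2 * c' * mass b s.density (S.near \ S.beyond θ) := fun c c' hc hc' ↦ by
    rcases h1.eq_or_lt with h0 | h0
    · rw [← h0] at hadd ⊢
      have : 0 < mass b s.density (S.near \ S.beyond θ) := by linarith
      positivity
    · positivity
  have hz : z = S.toward ∨ z = -S.toward := by
    have hz0 := h.2
    clear h
    rcases S.toward_beyond with h' | h' <;> rw [h'.1] <;> revert z <;> decide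
  rcases hz with rfl | rfl
  · rw [State.move_of_toward S hs hρ _ S.near_meas]
    exact key _ _ hp0 (by linarith)
  · rw [State.move_of_neg_toward S hs hρ _ S.near_meas]
    exact key _ _ (by linarith) hp0

/-- Contraction of the potential under one move, where `u` and `d` are the probabilities of the
signal into the side and of the opposite signal. -/
lemma StepConstants.potentialOf_step {p h κ σ τ l₁ l : ℝ}
    (hc : StepConstants p h κ σ τ l₁ l) (hp : 1 / 2 < p) (hp1 : p < 1) (hh : h < 1 - p)
    {t b u d : ℝ} (S : Side t) {s : State} (hs : s.running = true)
    (hρ : IsDensity b s.density) (hpos : 0 < mass b s.density S.near)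
    (hu0 : 0 ≤ u) (hd0 : 0 ≤ d) (hud : u + d ≤ 1) (hdκ : d ≤ 1 - κ)
    (hd : PointsTo t (median b s.density) S.toward → d ≤ h)
    (hu : PointsTo t (median b s.density) (-S.toward) → u ≤ h) :
    u * S.potentialOf p σ τ b (s.move p (median b s.density) S.toward).density
      + d * S.potentialOf p σ τ b (s.move p (median b s.density) (-S.toward)).density
      ≤ l * S.potentialOf p σ τ b s.density := by
  set θ := median b s.density
  have hH := S.mass_beyond_median hρ
  have hHm := S.beyond_meas θ
  unfold Side.potentialOf
  rw [State.move_of_toward S hs hρ _ S.near_meas, State.move_of_toward S hs hρ _ S.far_meas,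
    State.move_of_neg_toward S hs hρ _ S.near_meas, State.move_of_neg_toward S hs hρ _ S.far_meas]
  have hN := hρ.mass_inter_add_diff S.near hHm
  have hF := hρ.mass_inter_add_diff S.far hHm
  have hNF := S.mass_near_add_far_le hρ
  have hN1 := hρ.mass_nonneg (S.near ∩ S.beyond θ)
  have hN2 := hρ.mass_nonneg (S.near \ S.beyond θ)
  have hF1 := hρ.mass_nonneg (S.far ∩ S.beyond θ)
  have hF2 := hρ.mass_nonneg (S.far \ S.beyond θ)
  -- the mass beyond the query point which belongs to this side
  have hsplit : mass b s.density (S.near ∩ S.beyond θ) + mass b s.density (S.far ∩ S.beyond θ)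
      = mass b s.density ((S.near ∪ S.far) ∩ S.beyond θ) := by
    rw [← hρ.mass_inter_add_diff ((S.near ∪ S.far) ∩ S.beyond θ) S.near_meas]
    congr 2
    · ext x; simp only [Set.mem_inter_iff, Set.mem_union]; tauto
    · ext x
      have : x ∈ S.near → x ∉ S.far := fun hx ↦ Set.disjoint_left.1 S.disjoint hx
      simp only [Set.mem_inter_iff, Set.mem_sdiff, Set.mem_union]; tauto
  have hempty : mass b s.density ∅ = 0 := by unfold mass; simp
  rcases S.zones θ with ⟨hz, hn, hf⟩ | ⟨hz, hf, hsub⟩ | ⟨hz, hn, hsub⟩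
  · have hle := hρ.mass_mono ((S.near_meas.union S.far_meas).inter hHm)
      (Set.inter_subset_right : (S.near ∪ S.far) ∩ S.beyond θ ⊆ S.beyond θ)
    rw [← hsplit, Set.inter_eq_left.2 hn, Set.inter_eq_left.2 hf, hH] at hle
    rw [Set.inter_eq_left.2 hn, Set.inter_eq_left.2 hf, Set.sdiff_eq_empty.2 hn,
      Set.sdiff_eq_empty.2 hf, hempty]
    simpa using hc.potential_step_out hp hp1 hpos (hρ.mass_nonneg _) hle hd0 hu0 hud (hd hz)
  · rw [Set.inter_eq_right.2 hsub, hH, Set.inter_eq_left.2 hf] at hsplit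
    have := hc.potential_step_near hp hp1 hh hN2 hN1 (by linarith) (hρ.mass_nonneg S.far) hsplit
      (by linarith) hu0 hd0 hud (hu hz) hdκ
    rw [Set.inter_eq_left.2 hf, Set.sdiff_eq_empty.2 hf, hempty, mul_zero, add_zero, mul_zero,
      add_zero]
    rw [add_comm (mass b s.density (S.near \ S.beyond θ)), hN] at this
    rwa [add_comm (2 * p * mass b s.density (S.near ∩ S.beyond θ)),
      add_comm (2 * (1 - p) * mass b s.density (S.near ∩ S.beyond θ))]
  · have hn' := Set.disjoint_iff_inter_eq_empty.1 hn
    rw [Set.inter_eq_right.2 hsub, hH, hn', hempty, zero_add] at hsplit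
    have := hc.potential_step_far hp hp1 hpos hF2 hu0 hd0 hud (hu hz) hdκ
    rw [hn', hempty, hn.sdiff_eq_left, mul_zero, zero_add, mul_zero, zero_add, hsplit,
      add_comm (2 * p * (1 / 2)), add_comm (2 * (1 - p) * (1 / 2))]
    rw [← hsplit, add_comm (mass b s.density (S.far \ S.beyond θ)), hF] at this
    rw [← hsplit]
    exact this

/-- A query point in the far part forces the potential to be at least `1`. -/
lemma StepConstants.one_le_potentialOf {p h κ σ τ l₁ l : ℝ}
    (hc : StepConstants p h κ σ τ l₁ l) {t b : ℝ} (S : Side t) {ρ : ℝ → ℝ}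
    (hρ : IsDensity b ρ) (hpos : 0 < mass b ρ S.near) (hθ : median b ρ ∈ S.far) :
    1 ≤ S.potentialOf p σ τ b ρ := by
  refine hc.one_le_potential hpos ?_ (S.mass_near_add_far_le hρ)
  rw [← S.mass_beyond_median hρ]
  exact hρ.mass_mono (S.beyond_meas _) (S.beyond_subset _ hθ)

/-! ### Pathwise properties of the power-one test -/

/-- The walk of the signs `z` is outside the boundary at time `m`. -/
def Crosses (η : ℝ) (z : ℕ → ℝ) (m : ℕ) : Prop := 1 ≤ m ∧ boundary η m ≤ |walk z m|

lemma walk_neg (z : ℕ → ℝ) (m : ℕ) : walk (-z) m = -walk z m := by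
  simp [walk]

lemma walk_mono {z z' : ℕ → ℝ} (h : ∀ i, z' i ≤ z i) (m : ℕ) : walk z' m ≤ walk z m :=
  Finset.sum_le_sum fun i _ ↦ h i

lemma crosses_neg {η : ℝ} {z : ℕ → ℝ} {m : ℕ} : Crosses η (-z) m ↔ Crosses η z m := by
  simp [Crosses, walk_neg]

lemma log_sub_log_pos {η : ℝ} (hη : 0 < η) (hη' : η < 1) (m : ℕ) :
    0 < Real.log (m + 1) - Real.log η := by
  have h1 : Real.log η < 0 := Real.log_neg hη hη'
  have h2 : 0 ≤ Real.log ((m : ℝ) + 1) := Real.log_nonneg (by linarith [m.cast_nonneg (α := ℝ)])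
  linarith

lemma boundary_pos {η : ℝ} (hη : 0 < η) (hη' : η < 1) {m : ℕ} (hm : 1 ≤ m) :
    0 < boundary η m := by
  have h1 : (0 : ℝ) < m := by exact_mod_cast hm
  exact Real.sqrt_pos.2 (mul_pos (by positivity) (log_sub_log_pos hη hη' m))

lemma testOutcome_eq_iff {η : ℝ} {z : ℕ → ℝ} {s : SignType} : testOutcome η z = s ↔
    (∃ m, Crosses η z m ∧ (∀ j < m, ¬ Crosses η z j) ∧ SignType.sign (walk z m) = s) ∨
      ((∀ m, ¬ Crosses η z m) ∧ s = 0) := by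
  classical
  unfold testOutcome
  split_ifs with h
  · constructor
    · intro hs
      exact Or.inl ⟨Nat.find h, Nat.find_spec h, fun j hj ↦ Nat.find_min h hj, hs⟩
    · rintro (⟨m, hm, hmin, hs⟩ | ⟨hno, -⟩)
      · rwa [(Nat.find_eq_iff h).2 ⟨hm, hmin⟩]
      · exact absurd h.choose_spec (hno _)
  · constructor
    · intro hs
      exact Or.inr ⟨fun m hm ↦ h ⟨m, hm⟩, hs.symm⟩
    · rintro (⟨m, hm, -⟩ | ⟨-, hs⟩)
      · exact absurd ⟨m, hm⟩ h
      · exact hs.symm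

lemma testOutcome_neg (η : ℝ) (z : ℕ → ℝ) : testOutcome η (-z) = -testOutcome η z := by
  rw [testOutcome_eq_iff]
  rcases testOutcome_eq_iff.1 (rfl : testOutcome η z = testOutcome η z) with
    ⟨m, hm, hmin, hs⟩ | ⟨hno, h0⟩
  · refine Or.inl ⟨m, crosses_neg.2 hm, fun j hj ↦ fun h ↦ hmin j hj (crosses_neg.1 h), ?_⟩
    rw [walk_neg, ← hs, Left.sign_neg]
  · exact Or.inr ⟨fun m h ↦ hno m (crosses_neg.1 h), by rw [h0]; rfl⟩

/-- Lowering the signs preserves a negative outcome: a walk below another one cannot reach the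
upper boundary first, and reaches the lower boundary no later. -/
lemma testOutcome_neg_one_of_le {η : ℝ} (hη : 0 < η) (hη' : η < 1) {z z' : ℕ → ℝ}
    (h : ∀ i, z' i ≤ z i) (hz : testOutcome η z = -1) : testOutcome η z' = -1 := by
  classical
  rcases testOutcome_eq_iff.1 hz with ⟨m, hm, hmin, hs⟩ | ⟨-, h0⟩
  swap
  · exact absurd h0 (by decide)
  have hneg : walk z m < 0 := sign_eq_neg_one_iff.1 hs
  have hb := hm.2
  rw [abs_of_neg hneg] at hb
  have hcross' : Crosses η z' m := ⟨hm.1, by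
    have := walk_mono h m
    rw [abs_of_neg (by linarith)]
    linarith⟩
  have hex : ∃ m, Crosses η z' m := ⟨m, hcross'⟩
  refine testOutcome_eq_iff.2 (Or.inl ⟨Nat.find hex, Nat.find_spec hex,
    fun j hj ↦ Nat.find_min hex hj, sign_eq_neg_one_iff.2 ?_⟩)
  set n := Nat.find hex with hn
  have hnm : n ≤ m := Nat.find_min' hex hcross'
  have hnc : Crosses η z' n := Nat.find_spec hex
  have hbn := boundary_pos hη hη' hnc.1
  by_contra hge
  push Not at hge
  have h1 := hnc.2
  rw [abs_of_nonneg hge] at h1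
  have h2 := walk_mono h n
  rcases hnm.eq_or_lt with he | hlt
  · rw [he] at h2 hge
    linarith
  · exact hmin n hlt ⟨hnc.1, h1.trans (h2.trans (le_abs_self _))⟩

lemma testOutcome_one_of_le {η : ℝ} (hη : 0 < η) (hη' : η < 1) {z z' : ℕ → ℝ}
    (h : ∀ i, z i ≤ z' i) (hz : testOutcome η z = 1) : testOutcome η z' = 1 := by
  have h1 : testOutcome η (-z') = -1 :=
    testOutcome_neg_one_of_le hη hη' (z := -z) (fun i ↦ neg_le_neg (h i))
      (by rw [testOutcome_neg, hz])
  rw [testOutcome_neg] at h1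
  rw [← neg_neg (testOutcome η z'), h1]
  rfl

/-- Unanimous answers decide the test as soon as the boundary is below the diagonal. -/
lemma testOutcome_eq_one_of_forall {η : ℝ} {z : ℕ → ℝ} {m : ℕ} (hm : 1 ≤ m)
    (hb : boundary η m ≤ m) (hz : ∀ i < m, z i = 1) : testOutcome η z = 1 := by
  classical
  have hw : ∀ n ≤ m, walk z n = n := fun n hn ↦ by
    unfold walk
    rw [Finset.sum_congr rfl fun i hi ↦ hz i ((Finset.mem_range.1 hi).trans_le hn)]
    simp
  have hex : ∃ m, Crosses η z m := ⟨m, hm, by rw [hw m le_rfl]; simpa using hb⟩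
  have hle : Nat.find hex ≤ m := Nat.find_min' hex ⟨hm, by rw [hw m le_rfl]; simpa using hb⟩
  refine testOutcome_eq_iff.2 (Or.inl ⟨Nat.find hex, Nat.find_spec hex,
    fun j hj ↦ Nat.find_min hex hj, ?_⟩)
  rw [hw _ hle, sign_eq_one_iff]
  exact_mod_cast (Nat.find_spec hex).1

lemma testOutcome_eq_neg_one_of_forall {η : ℝ} {z : ℕ → ℝ} {m : ℕ} (hm : 1 ≤ m)
    (hb : boundary η m ≤ m) (hz : ∀ i < m, z i = -1) : testOutcome η z = -1 := by
  have h1 := testOutcome_eq_one_of_forall (z := -z) hm hb fun i hi ↦ by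
    rw [Pi.neg_apply, hz i hi, neg_neg]
  rw [testOutcome_neg] at h1
  rw [← neg_neg (testOutcome η z), h1]

lemma eventually_boundary_le (η : ℝ) {c : ℝ} (hc : 0 < c) :
    ∀ᶠ m : ℕ in Filter.atTop, boundary η m ≤ c * m := by
  have h1 : Filter.Tendsto (fun m : ℕ ↦ Real.log ((m : ℝ) + 1) / m) Filter.atTop (nhds 0) := by
    have h := (Real.tendsto_pow_log_div_mul_add_atTop 1 (-1) 1 one_ne_zero).comp
      (Filter.tendsto_atTop_add_const_right _ (1 : ℝ) tendsto_natCast_atTop_atTop)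
    refine h.congr fun m ↦ ?_
    simp
  have h2 : Filter.Tendsto (fun m : ℕ ↦ Real.log η / m) Filter.atTop (nhds 0) :=
    tendsto_const_nhds.div_atTop tendsto_natCast_atTop_atTop
  have h3 : Filter.Tendsto (fun m : ℕ ↦ 2 * (Real.log ((m : ℝ) + 1) / m - Real.log η / m))
      Filter.atTop (nhds 0) := by
    simpa using (h1.sub h2).const_mul 2
  filter_upwards [h3.eventually_lt_const (by positivity : (0 : ℝ) < c ^ 2),
    Filter.eventually_gt_atTop 0] with m hm hm0
  have hm0' : (0 : ℝ) < m := by exact_mod_cast hm0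
  refine Real.sqrt_le_iff.2 ⟨by positivity, ?_⟩
  have h4 : 2 * (Real.log ((m : ℝ) + 1) / m - Real.log η / m)
      = 2 * m * (Real.log (m + 1) - Real.log η) / m ^ 2 := by
    field_simp
  rw [h4, div_lt_iff₀ (by positivity)] at hm
  linarith

lemma measurable_walk (m : ℕ) : Measurable fun z : ℕ → ℝ ↦ walk z m := by
  unfold walk
  fun_prop

lemma measurableSet_crosses (η : ℝ) (m : ℕ) : MeasurableSet {z : ℕ → ℝ | Crosses η z m} :=
  (MeasurableSet.const _).inter
    (measurableSet_le measurable_const (measurable_walk m).abs)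

lemma measurableSet_testOutcome (η : ℝ) (s : SignType) :
    MeasurableSet {z : ℕ → ℝ | testOutcome η z = s} := by
  have hsign : ∀ m, MeasurableSet {z : ℕ → ℝ | SignType.sign (walk z m) = s} := fun m ↦ by
    rcases s with _ | _ | _
    · rw [show {z : ℕ → ℝ | SignType.sign (walk z m) = SignType.zero} = {z | walk z m = 0} from
        Set.ext fun z ↦ sign_eq_zero_iff]
      exact measurableSet_eq_fun (measurable_walk m) measurable_const
    · rw [show {z : ℕ → ℝ | SignType.sign (walk z m) = SignType.neg} = {z | walk z m < 0} from
        Set.ext fun z ↦ sign_eq_neg_one_iff]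
      exact measurableSet_lt (measurable_walk m) measurable_const
    · rw [show {z : ℕ → ℝ | SignType.sign (walk z m) = SignType.pos} = {z | 0 < walk z m} from
        Set.ext fun z ↦ sign_eq_one_iff]
      exact measurableSet_lt measurable_const (measurable_walk m)
  have : {z : ℕ → ℝ | testOutcome η z = s} =
      (⋃ m, {z | Crosses η z m} ∩ ((⋂ j, ⋂ (_ : j < m), {z | Crosses η z j}ᶜ) ∩
        {z | SignType.sign (walk z m) = s})) ∪
      ((⋂ m, {z | Crosses η z m}ᶜ) ∩ {_z | s = 0}) := by
    ext z
    simp only [Set.mem_ofPred_eq, testOutcome_eq_iff, Set.mem_union, Set.mem_iUnion,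
      Set.mem_inter_iff, Set.mem_iInter, Set.mem_compl_iff]
  rw [this]
  refine (MeasurableSet.iUnion fun m ↦ (measurableSet_crosses η m).inter
    ((MeasurableSet.iInter fun j ↦ MeasurableSet.iInter fun _ ↦
      (measurableSet_crosses η j).compl).inter (hsign m))).union
    ((MeasurableSet.iInter fun m ↦ (measurableSet_crosses η m).compl).inter (MeasurableSet.const _))

/-! ### The error probability of the test for a fair walk -/

/-- The likelihood ratio of the uniform mixture of all coins against the fair coin, after `n`
tosses with `h` heads. -/
noncomputable def mixtureRatio (n h : ℕ) : ℝ :=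
  2 ^ n * (h.factorial * (n - h).factorial) / (n + 1).factorial

lemma mixtureRatio_nonneg (n h : ℕ) : 0 ≤ mixtureRatio n h := by
  unfold mixtureRatio
  positivity

/-- The mixture ratio is a martingale under the fair coin. -/
lemma mixtureRatio_step {n h : ℕ} (hn : h ≤ n) :
    mixtureRatio (n + 1) (h + 1) + mixtureRatio (n + 1) h = 2 * mixtureRatio n h := by
  obtain ⟨k, rfl⟩ := Nat.exists_eq_add_of_le hn
  unfold mixtureRatio
  have h1 : h + k + 1 - (h + 1) = k := by omega
  have h2 : h + k + 1 - h = k + 1 := by omega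
  have h3 : h + k - h = k := by omega
  rw [h1, h2, h3, Nat.factorial_succ (h + k + 1), Nat.factorial_succ h, Nat.factorial_succ k]
  push_cast
  field_simp
  ring

/-- A bound for a single binomial probability, by Chernoff's method. -/
lemma choose_le_exp {n h : ℕ} (hn : 1 ≤ n) (hh : h ≤ n) :
    (n.choose h : ℝ) ≤ 2 ^ n * Real.exp (-((2 * h - n) ^ 2 / (2 * n))) := by
  have hn0 : (0 : ℝ) < n := by exact_mod_cast hn
  set x : ℝ := (2 * h - n) / n with hx
  have h1 : Real.exp x ^ h * Real.exp (-x) ^ (n - h) * n.choose h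
      ≤ (Real.exp x + Real.exp (-x)) ^ n := by
    rw [add_pow]
    exact Finset.single_le_sum
      (f := fun m ↦ Real.exp x ^ m * Real.exp (-x) ^ (n - m) * (n.choose m : ℝ))
      (fun i _ ↦ by positivity) (Finset.mem_range.2 (by omega))
  have h2 : (Real.exp x + Real.exp (-x)) ^ n ≤ 2 ^ n * Real.exp (n * (x ^ 2 / 2)) := by
    have h3 : Real.exp x + Real.exp (-x) ≤ 2 * Real.exp (x ^ 2 / 2) := by
      have := Real.cosh_le_exp_half_sq x
      rw [Real.cosh_eq] at this
      linarith
    calc (Real.exp x + Real.exp (-x)) ^ n ≤ (2 * Real.exp (x ^ 2 / 2)) ^ n :=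
          pow_le_pow_left₀ (by positivity) h3 n
      _ = 2 ^ n * Real.exp (n * (x ^ 2 / 2)) := by rw [mul_pow, ← Real.exp_nat_mul]
  have h4 : Real.exp x ^ h * Real.exp (-x) ^ (n - h) = Real.exp (x * (2 * h - n)) := by
    rw [← Real.exp_nat_mul, ← Real.exp_nat_mul, ← Real.exp_add, Nat.cast_sub hh]
    congr 1
    ring
  rw [h4] at h1
  have h5 := h1.trans h2
  have h6 : Real.exp (n * (x ^ 2 / 2))
      = Real.exp (x * (2 * h - n)) * Real.exp (-((2 * h - n) ^ 2 / (2 * n))) := by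
    rw [← Real.exp_add]
    congr 1
    rw [hx]
    field_simp
    ring
  rw [h6] at h5
  have h7 := Real.exp_pos (x * (2 * h - n))
  refine le_of_mul_le_mul_left ?_ h7
  linarith

lemma one_le_mixtureRatio {η : ℝ} (hη : 0 < η) {n h : ℕ} (hn : 1 ≤ n) (hh : h ≤ n)
    (hb : boundary η n ≤ |(2 * h - n : ℝ)|) : 1 ≤ η * mixtureRatio n h := by
  have hn0 : (0 : ℝ) < n := by exact_mod_cast hn
  have h1 : 2 * n * (Real.log (n + 1) - Real.log η) ≤ (2 * h - n : ℝ) ^ 2 := by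
    rw [← sq_abs]
    exact (Real.sqrt_le_left (abs_nonneg _)).1 hb
  have h2 : Real.exp (-((2 * h - n : ℝ) ^ 2 / (2 * n))) ≤ η / (n + 1) := by
    rw [← Real.exp_log (div_pos hη (by linarith : (0 : ℝ) < n + 1)), Real.exp_le_exp,
      Real.log_div hη.ne' (by linarith)]
    have : Real.log (n + 1) - Real.log η ≤ (2 * h - n : ℝ) ^ 2 / (2 * n) := by
      rw [le_div_iff₀ (by linarith)]
      linarith
    linarith
  have h3 : (n.choose h : ℝ) ≤ 2 ^ n * (η / (n + 1)) :=
    (choose_le_exp hn hh).trans (mul_le_mul_of_nonneg_left h2 (by positivity))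
  have h4 : (0 : ℝ) < n.choose h := by exact_mod_cast Nat.choose_pos hh
  have h5 : mixtureRatio n h = 2 ^ n / ((n + 1) * n.choose h) := by
    have := Nat.choose_mul_factorial_mul_factorial hh
    have h6 : (n.factorial : ℝ) = n.choose h * h.factorial * (n - h).factorial := by
      exact_mod_cast this.symm
    unfold mixtureRatio
    rw [Nat.factorial_succ]
    push_cast
    rw [h6]
    field_simp
  rw [h5, ← mul_div_assoc, one_le_div (by positivity)]
  have h6 : (n + 1 : ℝ) * (2 ^ n * (η / (n + 1))) = η * 2 ^ n := by field_simp
  have h7 := mul_le_mul_of_nonneg_left h3 (by linarith : (0 : ℝ) ≤ n + 1)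
  linarith

/-- The number of positive signs among the first `n`. -/
noncomputable def positives (z : ℕ → ℝ) (n : ℕ) : ℕ :=
  ∑ i ∈ Finset.range n, if z i = 1 then 1 else 0

lemma positives_le (z : ℕ → ℝ) (n : ℕ) : positives z n ≤ n := by
  unfold positives
  refine (Finset.sum_le_sum (g := fun _ ↦ 1) fun i _ ↦ ?_).trans_eq (by simp)
  split_ifs <;> simp

lemma walk_eq_positives {z : ℕ → ℝ} (hz : ∀ i, z i = 1 ∨ z i = -1) (n : ℕ) :
    walk z n = 2 * positives z n - n := by
  induction n with
  | zero => simp [walk, positives]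
  | succ n ih =>
    unfold walk positives at *
    rw [Finset.sum_range_succ, Finset.sum_range_succ, ih]
    rcases hz n with h | h <;> rw [h] <;> norm_num <;> ring

/-- Ville's inequality for the mixture martingale: a walk with independent fair signs ever crosses
the boundary with probability at most `η`. -/
lemma measure_exists_crosses_le {Ω : Type*} {mΩ : MeasurableSpace Ω} {P : Measure Ω}
    [IsProbabilityMeasure P] {η : ℝ} (hη : 0 < η) {z : ℕ → Ω → ℝ} {F G : ℕ → MeasurableSpace Ω}
    (hF : ∀ n, F n ≤ mΩ) (hG : ∀ n, G n ≤ mΩ) (hFG : ∀ n, Indep (F n) (G n) P)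
    (hzF : ∀ n, ∀ i < n, Measurable[F n] (z i)) (hzG : ∀ n, Measurable[G n] (z n))
    (hz : ∀ i ω, z i ω = 1 ∨ z i ω = -1) (hfair : ∀ n, P {ω | z n ω = 1} = 2⁻¹)
    (hfair' : ∀ n, P {ω | z n ω = -1} = 2⁻¹) :
    P {ω | ∃ m, Crosses η (z · ω) m} ≤ ENNReal.ofReal η := by
  classical
  set C : ℕ → Set Ω := fun n ↦ {ω | ∃ m ≤ n, Crosses η (z · ω) m} with hC
  -- the mixture ratio after `n + e` tosses of which `c` additional ones are heads, frozen at the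
  -- value `1` once the boundary has been crossed by time `n`
  set V : ℕ → ℕ → ℕ → Ω → ENNReal := fun n e c ω ↦ if ω ∈ C n then 1 else
    ENNReal.ofReal (η * mixtureRatio (n + e) (positives (z · ω) n + c)) with hV
  have hwalk : ∀ n, ∀ m ≤ n, Measurable[F n] fun ω ↦ walk (z · ω) m := fun n m hm ↦
    Finset.measurable_fun_sum _ fun i hi ↦ hzF n i ((Finset.mem_range.1 hi).trans_le hm)
  have hCmeas : ∀ n, MeasurableSet[F n] (C n) := fun n ↦ by
    have : C n = ⋃ m, ⋃ (_ : m ≤ n), {ω | Crosses η (z · ω) m} := by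
      ext ω; simp [hC]
    rw [this]
    refine MeasurableSet.iUnion fun m ↦ MeasurableSet.iUnion fun hm ↦ ?_
    exact (MeasurableSet.const _).inter
      (hwalk n m hm (measurableSet_le measurable_const measurable_id.abs))
  have hpos : ∀ n, Measurable[F n] fun ω ↦ positives (z · ω) n := fun n ↦
    Finset.measurable_fun_sum _ fun i hi ↦
      Measurable.ite (hzF n i (Finset.mem_range.1 hi) (measurableSet_singleton 1))
        measurable_const measurable_const
  have hVmeas : ∀ n e c, Measurable[F n] (V n e c) := fun n e c ↦ by
    refine Measurable.ite (hCmeas n) measurable_const ?_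
    exact (Measurable.of_discrete (f := fun k : ℕ ↦
      ENNReal.ofReal (η * mixtureRatio (n + e) (k + c)))).comp (hpos n)
  have hind : ∀ n (x : ℝ), Measurable[G n] (Set.indicator {ω | z n ω = x} (1 : Ω → ENNReal)) :=
    fun n x ↦ Measurable.indicator (m := G n) (@measurable_const ENNReal Ω _ (G n) 1)
      (hzG n (measurableSet_singleton x))
  have hle : ∀ n ω, V (n + 1) 0 0 ω ≤
      V n 1 1 ω * Set.indicator {ω | z n ω = 1} (1 : Ω → ENNReal) ω
        + V n 1 0 ω * Set.indicator {ω | z n ω = -1} (1 : Ω → ENNReal) ω := by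
    intro n ω
    have hstep : V (n + 1) 0 0 ω ≤ if ω ∈ C n then 1 else
        ENNReal.ofReal (η * mixtureRatio (n + 1) (positives (z · ω) (n + 1))) := by
      by_cases h1 : ω ∈ C n
      · have : ω ∈ C (n + 1) := by
          obtain ⟨m, hm, hm'⟩ := h1
          exact ⟨m, by omega, hm'⟩
        simp [hV, h1, this]
      · by_cases h2 : ω ∈ C (n + 1)
        · have h3 : Crosses η (z · ω) (n + 1) := by
            obtain ⟨m, hm, hm'⟩ := h2
            rcases Nat.lt_or_ge m (n + 1) with h | h
            · exact absurd ⟨m, by omega, hm'⟩ h1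
            · rwa [le_antisymm hm h] at hm'
          simp only [hV, if_neg h1, if_pos h2]
          rw [ENNReal.one_le_ofReal]
          have h4 := h3.2
          rw [walk_eq_positives (fun i ↦ hz i ω)] at h4
          exact one_le_mixtureRatio hη h3.1 (positives_le _ _) h4
        · simp [hV, h1, h2]
    refine hstep.trans ?_
    have hp : positives (z · ω) (n + 1) = positives (z · ω) n + if z n ω = 1 then 1 else 0 := by
      unfold positives
      rw [Finset.sum_range_succ]
    rw [hp]
    rcases hz n ω with h | h
    · simp [hV, h]
    · have h' : ¬ (-1 : ℝ) = 1 := by norm_num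
      simp [hV, h, h']
  have hmean : ∀ n ω, V n 1 1 ω * 2⁻¹ + V n 1 0 ω * 2⁻¹ = V n 0 0 ω := by
    intro n ω
    by_cases h1 : ω ∈ C n
    · simp [hV, h1, ENNReal.inv_two_add_inv_two]
    · simp only [hV, if_neg h1]
      rw [← add_mul, ← ENNReal.ofReal_add (mul_nonneg hη.le (mixtureRatio_nonneg _ _))
        (mul_nonneg hη.le (mixtureRatio_nonneg _ _)), ← mul_add, add_zero,
        mixtureRatio_step (positives_le _ _), mul_left_comm, mul_comm (2 : ℝ),
        ENNReal.ofReal_mul (mul_nonneg hη.le (mixtureRatio_nonneg _ _)), mul_assoc,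
        ENNReal.ofReal_ofNat, ENNReal.mul_inv_cancel two_ne_zero ENNReal.ofNat_ne_top, mul_one,
        add_zero]
  have hanti : ∀ n, ∫⁻ ω, V (n + 1) 0 0 ω ∂P ≤ ∫⁻ ω, V n 0 0 ω ∂P := by
    intro n
    have hmV : ∀ e c, Measurable (V n e c) := fun e c ↦ (hVmeas n e c).mono (hF n) le_rfl
    have hmz : ∀ x : ℝ, MeasurableSet {ω | z n ω = x} :=
      fun x ↦ hG n _ (hzG n (measurableSet_singleton x))
    have hprod : ∀ c (x : ℝ), P {ω | z n ω = x} = 2⁻¹ →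
        ∫⁻ ω, V n 1 c ω * Set.indicator {ω | z n ω = x} (1 : Ω → ENNReal) ω ∂P
          = ∫⁻ ω, V n 1 c ω * 2⁻¹ ∂P := fun c x hx ↦ by
      rw [lintegral_mul_eq_lintegral_mul_lintegral_of_independent_measurableSpace (hF n) (hG n)
        (hFG n) (hVmeas n 1 c) (hind n x), lintegral_indicator_one (hmz x), hx,
        lintegral_mul_const _ (hmV 1 c)]
    calc ∫⁻ ω, V (n + 1) 0 0 ω ∂P
        ≤ ∫⁻ ω, (V n 1 1 ω * Set.indicator {ω | z n ω = 1} (1 : Ω → ENNReal) ω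
          + V n 1 0 ω * Set.indicator {ω | z n ω = -1} (1 : Ω → ENNReal) ω) ∂P :=
          lintegral_mono (hle n)
      _ = ∫⁻ ω, (V n 1 1 ω * 2⁻¹ + V n 1 0 ω * 2⁻¹) ∂P := by
          rw [lintegral_add_left (f := fun ω ↦ V n 1 1 ω * _)
              ((hmV 1 1).mul (measurable_one.indicator (hmz 1))),
            lintegral_add_left ((hmV 1 1).mul_const _), hprod 1 1 (hfair n),
            hprod 0 (-1) (hfair' n)]
      _ = ∫⁻ ω, V n 0 0 ω ∂P := lintegral_congr (hmean n)
  have hbound : ∀ n, ∫⁻ ω, V n 0 0 ω ∂P ≤ ENNReal.ofReal η := by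
    intro n
    induction n with
    | zero =>
      have : ∀ ω, V 0 0 0 ω = ENNReal.ofReal η := fun ω ↦ by
        have h1 : ω ∉ C 0 := by
          rintro ⟨m, hm, hm'⟩
          have := hm'.1
          omega
        simp [hV, h1, positives, mixtureRatio]
      simp [this]
    | succ n ih => exact (hanti n).trans ih
  have hCn : ∀ n, P (C n) ≤ ENNReal.ofReal η := fun n ↦ by
    refine le_trans ?_ (hbound n)
    rw [← lintegral_indicator_one (hF n _ (hCmeas n))]
    refine lintegral_mono fun ω ↦ ?_
    by_cases h : ω ∈ C n <;> simp [hV, h]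
  have hunion : {ω | ∃ m, Crosses η (z · ω) m} = ⋃ n, C n := by
    ext ω
    simp only [Set.mem_ofPred_eq, Set.mem_iUnion, hC]
    exact ⟨fun ⟨m, hm⟩ ↦ ⟨m, m, le_rfl, hm⟩, fun ⟨_, m, _, hm⟩ ↦ ⟨m, hm⟩⟩
  have hmono : Monotone C := fun a b hab ω ⟨m, hm, hm'⟩ ↦ ⟨m, hm.trans hab, hm'⟩
  rw [hunion, hmono.measure_iUnion]
  exact iSup_le hCn

/-! ### The test under Gumbel noise -/

/-- The noise of all comparisons at one query point. -/
structure IsGumbelRow {Ω : Type*} [MeasurableSpace Ω] (P : Measure Ω) (γ : ℝ)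
    (Y : ℕ × Bool → Ω → ℝ) : Prop where
  measurable : ∀ j, Measurable (Y j)
  cdf_eq : ∀ j x, P.real {ω | Y j ω ≤ x} = Real.exp (-Real.exp (-x / γ))
  indep : iIndepFun Y P

lemma IsGumbelNoise.row {Ω : Type*} [MeasurableSpace Ω] {P : Measure Ω} {γ : ℝ}
    {ξ : ℕ → ℕ → Bool → Ω → ℝ} (h : IsGumbelNoise P γ ξ) (k : ℕ) :
    IsGumbelRow P γ fun j ↦ ξ k j.1 j.2 where
  measurable j := h.measurable k j.1 j.2
  cdf_eq j x := h.cdf_eq k j.1 j.2 x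
  indep := h.indep.precomp (g := fun j : ℕ × Bool ↦ (k, j)) fun _ _ hij ↦ (Prod.mk.inj hij).2

/-- The answers to the comparisons of a lower point of utility `a` and an upper point of
utility `c`, as a function of the noise. -/
noncomputable def noisyAnswers (a c : ℝ) (y : ℕ × Bool → ℝ) (i : ℕ) : ℝ :=
  if a + y (i, false) < c + y (i, true) then 1 else -1

lemma noisyAnswers_eq_or (a c : ℝ) (y : ℕ × Bool → ℝ) (i : ℕ) :
    noisyAnswers a c y i = 1 ∨ noisyAnswers a c y i = -1 := by
  unfold noisyAnswers
  split_ifs <;> simp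

lemma noisyAnswers_eq_one_iff {a c : ℝ} {y : ℕ × Bool → ℝ} {i : ℕ} :
    noisyAnswers a c y i = 1 ↔ a + y (i, false) < c + y (i, true) := by
  unfold noisyAnswers
  split_ifs with h
  · simp [h]
  · simp only [h, iff_false]
    norm_num

lemma noisyAnswers_le {a c a' c' : ℝ} (h : c - a ≤ c' - a') (y : ℕ × Bool → ℝ) (i : ℕ) :
    noisyAnswers a c y i ≤ noisyAnswers a' c' y i := by
  unfold noisyAnswers
  split_ifs <;> linarith

lemma measurable_noisyAnswers_apply (a c : ℝ) (i : ℕ) :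
    Measurable fun y : ℕ × Bool → ℝ ↦ noisyAnswers a c y i := by
  refine Measurable.ite (measurableSet_lt ?_ ?_) measurable_const measurable_const <;> fun_prop

lemma measurable_noisyAnswers (a c : ℝ) : Measurable (noisyAnswers a c) :=
  measurable_pi_iff.2 (measurable_noisyAnswers_apply a c)

/-- The set of noises for which the test ends with outcome `s`. -/
def outcomeSet (η a c : ℝ) (s : SignType) : Set (ℕ × Bool → ℝ) :=
  {y | testOutcome η (noisyAnswers a c y) = s}

lemma measurableSet_outcomeSet (η a c : ℝ) (s : SignType) :
    MeasurableSet (outcomeSet η a c s) :=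
  measurable_noisyAnswers a c (measurableSet_testOutcome η s)

namespace IsGumbelRow

variable {Ω : Type*} [mΩ : MeasurableSpace Ω] {P : Measure Ω} {γ : ℝ}
  {Y : ℕ × Bool → Ω → ℝ}

lemma measurable_row (hY : IsGumbelRow P γ Y) : Measurable fun ω j ↦ Y j ω :=
  measurable_pi_iff.2 hY.measurable

lemma measurableSet_outcome (hY : IsGumbelRow P γ Y) (η a c : ℝ) (s : SignType) :
    MeasurableSet {ω | testOutcome η (noisyAnswers a c (Y · ω)) = s} :=
  hY.measurable_row (measurableSet_outcomeSet η a c s)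

variable [IsProbabilityMeasure P]

lemma identDistrib (hY : IsGumbelRow P γ Y) (i j : ℕ × Bool) : IdentDistrib (Y i) (Y j) P P where
  aemeasurable_fst := (hY.measurable i).aemeasurable
  aemeasurable_snd := (hY.measurable j).aemeasurable
  map_eq := by
    have := Measure.isProbabilityMeasure_map (μ := P) (hY.measurable i).aemeasurable
    refine Measure.ext_of_Iic _ _ fun x ↦ ?_
    rw [Measure.map_apply (hY.measurable i) measurableSet_Iic,
      Measure.map_apply (hY.measurable j) measurableSet_Iic]
    have h := (hY.cdf_eq i x).trans (hY.cdf_eq j x).symm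
    exact (measureReal_eq_measureReal_iff).1 h

lemma measure_Ioc (hY : IsGumbelRow P γ Y) (j : ℕ × Bool) {x y : ℝ} (hxy : x ≤ y) :
    P.real {ω | Y j ω ∈ Set.Ioc x y}
      = Real.exp (-Real.exp (-y / γ)) - Real.exp (-Real.exp (-x / γ)) := by
  rw [← hY.cdf_eq j, ← hY.cdf_eq j, ← measureReal_sdiff]
  · congr 1
    ext ω
    simp only [Set.mem_ofPred_eq, Set.mem_Ioc, Set.mem_sdiff, not_le]
    exact and_comm
  · exact fun ω (hω : _ ≤ x) ↦ hω.trans hxy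
  · exact hY.measurable j measurableSet_Iic

lemma measure_Ioc_pos (hY : IsGumbelRow P γ Y) (hγ : 0 < γ) (j : ℕ × Bool) {x y : ℝ}
    (hxy : x < y) : 0 < P.real {ω | Y j ω ∈ Set.Ioc x y} := by
  rw [hY.measure_Ioc j hxy.le, sub_pos, Real.exp_lt_exp, neg_lt_neg_iff, Real.exp_lt_exp]
  exact div_lt_div_of_pos_right (by linarith) hγ

lemma measure_eq_zero (hY : IsGumbelRow P γ Y) (j : ℕ × Bool) (x : ℝ) :
    P.real {ω | Y j ω = x} = 0 := by
  have hcont : ContinuousAt (fun y : ℝ ↦ Real.exp (-Real.exp (-x / γ))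
      - Real.exp (-Real.exp (-y / γ))) x := by fun_prop
  have hle : ∀ y < x, P.real {ω | Y j ω = x}
      ≤ Real.exp (-Real.exp (-x / γ)) - Real.exp (-Real.exp (-y / γ)) := fun y hy ↦ by
    rw [← hY.measure_Ioc j hy.le]
    exact measureReal_mono fun ω (hω : _ = x) ↦ by
      change Y j ω ∈ Set.Ioc y x
      rw [hω]
      exact ⟨hy, le_rfl⟩
  refine le_antisymm ?_ measureReal_nonneg
  have htend := hcont.tendsto.mono_left (nhdsWithin_le_nhds (s := Set.Iio x))
  rw [sub_self] at htend
  exact ge_of_tendsto htend (by filter_upwards [self_mem_nhdsWithin] with y hy using hle y hy)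

/-- Two noises at different places almost surely differ. -/
lemma ae_ne (hY : IsGumbelRow P γ Y) {i j : ℕ × Bool} (hij : i ≠ j) : ∀ᵐ ω ∂P, Y i ω ≠ Y j ω := by
  have hind := (indepFun_iff_map_prod_eq_prod_map_map (hY.measurable i).aemeasurable
    (hY.measurable j).aemeasurable).1 (hY.indep.indepFun hij)
  have hdiag : MeasurableSet {q : ℝ × ℝ | q.1 = q.2} :=
    measurableSet_eq_fun measurable_fst measurable_snd
  have h0 : P {ω | Y i ω = Y j ω} = 0 := by
    have h1 : P {ω | Y i ω = Y j ω}
        = P.map (fun ω ↦ (Y i ω, Y j ω)) {q : ℝ × ℝ | q.1 = q.2} :=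
      (Measure.map_apply ((hY.measurable i).prodMk (hY.measurable j)) hdiag).symm
    have := Measure.isProbabilityMeasure_map (μ := P) (hY.measurable j).aemeasurable
    rw [h1, hind, Measure.prod_apply hdiag]
    refine (lintegral_congr fun x ↦ ?_).trans lintegral_zero
    rw [Measure.map_apply (hY.measurable j) (measurable_prodMk_left hdiag)]
    have h2 := hY.measure_eq_zero j x
    rw [measureReal_eq_zero_iff] at h2
    rw [← h2]
    congr 1
    ext ω
    exact eq_comm
  exact measure_eq_zero_iff_ae_notMem.1 h0

/-- Exchanging the noises of the upper and of the lower points preserves the joint law. -/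
lemma identDistrib_swap (hY : IsGumbelRow P γ Y) :
    IdentDistrib (fun ω j ↦ Y j ω) (fun ω j ↦ Y (j.1, !j.2) ω) P P :=
  IdentDistrib.pi (fun j ↦ hY.identDistrib j (j.1, !j.2)) hY.indep
    (hY.indep.precomp (g := fun j : ℕ × Bool ↦ (j.1, !j.2)) fun i j h ↦ by
      simpa [Prod.ext_iff] using h)

/-- After the exchange, the answers of an indifferent human are negated. -/
lemma ae_noisyAnswers_swap (hY : IsGumbelRow P γ Y) : ∀ᵐ ω ∂P,
    noisyAnswers 0 0 (fun j ↦ Y (j.1, !j.2) ω) = -noisyAnswers 0 0 (Y · ω) := by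
  have h : ∀ᵐ ω ∂P, ∀ i : ℕ, Y (i, false) ω ≠ Y (i, true) ω :=
    ae_all_iff.2 fun i ↦ hY.ae_ne (by simp)
  filter_upwards [h] with ω hω
  ext i
  have := hω i
  simp only [noisyAnswers, Bool.not_false, Bool.not_true, zero_add, Pi.neg_apply]
  rcases lt_or_gt_of_ne this with h | h
  · rw [if_neg (by linarith), if_pos h]
  · rw [if_pos h, if_neg (by linarith), neg_neg]

lemma measure_fair_answer (hY : IsGumbelRow P γ Y) (i : ℕ) :
    P {ω | noisyAnswers 0 0 (Y · ω) i = 1} = 2⁻¹ ∧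
      P {ω | noisyAnswers 0 0 (Y · ω) i = -1} = 2⁻¹ := by
  have hm := measurable_noisyAnswers_apply 0 0 i
  have h1 : P {ω | noisyAnswers 0 0 (Y · ω) i = 1} = P {ω | noisyAnswers 0 0 (Y · ω) i = -1} := by
    have h2 := hY.identDistrib_swap.measure_mem_eq (hm (measurableSet_singleton 1))
    refine h2.trans (measure_congr ?_)
    filter_upwards [hY.ae_noisyAnswers_swap] with ω hω
    refine propext ?_
    change noisyAnswers 0 0 (fun j ↦ Y (j.1, !j.2) ω) i = 1 ↔ noisyAnswers 0 0 (Y · ω) i = -1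
    rw [hω, Pi.neg_apply, neg_eq_iff_eq_neg]
  have h3 : P {ω | noisyAnswers 0 0 (Y · ω) i = 1} + P {ω | noisyAnswers 0 0 (Y · ω) i = -1}
      = 1 := by
    rw [← measure_union]
    · rw [← measure_univ (μ := P)]
      congr 1
      ext ω
      simpa using noisyAnswers_eq_or 0 0 (Y · ω) i
    · refine Set.disjoint_left.2 fun ω (hω : _ = (1 : ℝ)) (hω' : _ = (-1 : ℝ)) ↦ ?_
      rw [hω] at hω'
      norm_num at hω'
    · exact (hm.comp hY.measurable_row) (measurableSet_singleton (-1))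
  rw [← h1, ← two_mul] at h3
  have h4 : P {ω | noisyAnswers 0 0 (Y · ω) i = 1} = 2⁻¹ := by
    exact ENNReal.eq_inv_of_mul_eq_one_left (by rwa [mul_comm] at h3)
  exact ⟨h4, h1 ▸ h4⟩

/-- For an indifferent human both outcomes have the same probability, hence at most `η / 2`. -/
lemma measure_fair_outcome_le (hY : IsGumbelRow P γ Y) {η : ℝ} (hη : 0 < η) :
    P.real {ω | testOutcome η (noisyAnswers 0 0 (Y · ω)) = 1} ≤ η / 2 ∧
      P.real {ω | testOutcome η (noisyAnswers 0 0 (Y · ω)) = -1} ≤ η / 2 := by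
  set O : SignType → Set Ω := fun s ↦ {ω | testOutcome η (noisyAnswers 0 0 (Y · ω)) = s} with hO
  have hsymm : P (O 1) = P (O (-1)) := by
    have h2 := hY.identDistrib_swap.measure_mem_eq (measurableSet_outcomeSet η 0 0 1)
    refine h2.trans (measure_congr ?_)
    filter_upwards [hY.ae_noisyAnswers_swap] with ω hω
    refine propext ?_
    change testOutcome η (noisyAnswers 0 0 (fun j ↦ Y (j.1, !j.2) ω)) = 1
      ↔ testOutcome η (noisyAnswers 0 0 (Y · ω)) = -1
    rw [hω, testOutcome_neg, neg_eq_iff_eq_neg]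
  set F : ℕ → MeasurableSpace Ω := fun n ↦
    ⨆ j ∈ {j : ℕ × Bool | j.1 < n}, MeasurableSpace.comap (Y j) inferInstance with hF
  set G : ℕ → MeasurableSpace Ω := fun n ↦
    ⨆ j ∈ {j : ℕ × Bool | j.1 = n}, MeasurableSpace.comap (Y j) inferInstance with hG
  have hle : ∀ j, MeasurableSpace.comap (Y j) inferInstance ≤ mΩ :=
    fun j ↦ (hY.measurable j).comap_le
  -- measurability of an answer with respect to the noises it depends on
  have hmeas : ∀ (T : Set (ℕ × Bool)) (i : ℕ), (i, false) ∈ T → (i, true) ∈ T →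
      Measurable[⨆ j ∈ T, MeasurableSpace.comap (Y j) inferInstance]
        fun ω ↦ noisyAnswers 0 0 (Y · ω) i := fun T i h0 h1 ↦ by
    have hYm : ∀ j ∈ T, Measurable[⨆ j ∈ T, MeasurableSpace.comap (Y j) inferInstance] (Y j) :=
      fun j hj ↦ Measurable.of_comap_le (le_biSup (f := fun j ↦ MeasurableSpace.comap (Y j) _) hj)
    have hq : Measurable fun q : ℝ × ℝ ↦ if 0 + q.1 < 0 + q.2 then (1 : ℝ) else -1 :=
      Measurable.ite (measurableSet_lt (by fun_prop) (by fun_prop)) measurable_const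
        measurable_const
    exact hq.comp ((hYm _ h0).prodMk (hYm _ h1))
  have hunion : P (O 1 ∪ O (-1)) ≤ ENNReal.ofReal η := by
    refine le_trans (measure_mono ?_) (measure_exists_crosses_le (P := P) hη
      (z := fun i ω ↦ noisyAnswers 0 0 (Y · ω) i) (F := F) (G := G)
      (fun n ↦ iSup₂_le fun j _ ↦ hle j) (fun n ↦ iSup₂_le fun j _ ↦ hle j)
      (fun n ↦ indep_iSup_of_disjoint hle hY.indep (Set.disjoint_left.2 ?_))
      (fun n i hi ↦ hmeas _ i hi hi) (fun n ↦ hmeas _ n rfl rfl)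
      (fun i ω ↦ noisyAnswers_eq_or 0 0 (Y · ω) i) (fun n ↦ (hY.measure_fair_answer n).1)
      (fun n ↦ (hY.measure_fair_answer n).2))
    · rintro ω (hω | hω) <;>
      · rcases testOutcome_eq_iff.1 hω with ⟨m, hm, -⟩ | ⟨-, h0⟩
        · exact ⟨m, hm⟩
        · exact absurd h0 (by decide)
    · rintro j (hj : j.1 < n) (hj' : j.1 = n)
      omega
  have hdisj : Disjoint (O 1) (O (-1)) :=
    Set.disjoint_left.2 fun ω (hω : _ = (1 : SignType)) (hω' : _ = (-1 : SignType)) ↦ by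
      rw [hω] at hω'
      exact absurd hω' (by decide)
  rw [measure_union hdisj (hY.measurableSet_outcome η 0 0 (-1)), ← hsymm, ← two_mul] at hunion
  have h1 : P.real (O 1) ≤ η / 2 := by
    have h2 := ENNReal.toReal_mono ENNReal.ofReal_ne_top hunion
    rw [ENNReal.toReal_mul, ENNReal.toReal_ofReal hη.le, ENNReal.toReal_ofNat] at h2
    change 2 * P.real (O 1) ≤ η at h2
    linarith
  refine ⟨h1, ?_⟩
  have h2 : P.real (O (-1)) = P.real (O 1) := by
    unfold Measure.real
    rw [hsymm]
  exact h2.trans_le h1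

/-- The test has the wrong outcome with probability at most `η / 2`. -/
lemma measure_outcome_neg_one_le (hY : IsGumbelRow P γ Y) {η a c : ℝ} (hη : 0 < η) (hη' : η < 1)
    (hac : a ≤ c) : P.real {ω | testOutcome η (noisyAnswers a c (Y · ω)) = -1} ≤ η / 2 :=
  le_trans (measureReal_mono fun ω hω ↦ testOutcome_neg_one_of_le hη hη'
    (noisyAnswers_le (by linarith) (Y · ω)) hω) (hY.measure_fair_outcome_le hη).2

lemma measure_outcome_one_le (hY : IsGumbelRow P γ Y) {η a c : ℝ} (hη : 0 < η) (hη' : η < 1)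
    (hca : c ≤ a) : P.real {ω | testOutcome η (noisyAnswers a c (Y · ω)) = 1} ≤ η / 2 :=
  le_trans (measureReal_mono fun ω hω ↦ testOutcome_one_of_le hη hη'
    (noisyAnswers_le (by linarith) (Y · ω)) hω) (hY.measure_fair_outcome_le hη).1

/-- The probability that in each of the first `m` comparisons the noise of the points marked by
`s` exceeds `Δ`, while the other noise is not positive. -/
lemma measure_unanimous (hY : IsGumbelRow P γ Y) (Δ : ℝ) (m : ℕ) (s : Bool) :
    P.real {ω | ∀ i < m, Δ < Y (i, s) ω ∧ Y (i, !s) ω ≤ 0}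
      = ((1 - Real.exp (-Real.exp (-Δ / γ))) * Real.exp (-1)) ^ m := by
  set A : ℕ × Bool → Set ℝ := fun j ↦ if j.2 = s then Set.Ioi Δ else Set.Iic 0 with hA
  have hAm : ∀ j, MeasurableSet (A j) := fun j ↦ by
    simp only [hA]
    split_ifs
    · exact measurableSet_Ioi
    · exact measurableSet_Iic
  have h1 := hY.indep.measure_inter_preimage_eq_mul (Finset.range m ×ˢ Finset.univ)
    (sets := A) (fun j _ ↦ hAm j)
  have h2 : {ω | ∀ i < m, Δ < Y (i, s) ω ∧ Y (i, !s) ω ≤ 0}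
      = ⋂ j ∈ Finset.range m ×ˢ (Finset.univ : Finset Bool), Y j ⁻¹' A j := by
    ext ω
    simp only [Set.mem_ofPred_eq, Set.mem_iInter, Finset.mem_product, Finset.mem_range,
      Finset.mem_univ, and_true, Set.mem_preimage, hA]
    constructor
    · rintro h ⟨i, b⟩ hi
      by_cases hb : b = s
      · subst hb
        simpa using (h i hi).1
      · have hb' : b = !s := by revert hb; cases b <;> cases s <;> decide
        subst hb'
        simpa using (h i hi).2
    · intro h i hi
      exact ⟨by simpa using h (i, s) hi, by simpa using h (i, !s) hi⟩
  have hs : ∀ i, P.real (Y (i, s) ⁻¹' A (i, s)) = 1 - Real.exp (-Real.exp (-Δ / γ)) := fun i ↦ by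
    rw [← hY.cdf_eq (i, s), show {ω | Y (i, s) ω ≤ Δ} = Y (i, s) ⁻¹' Set.Iic Δ from rfl,
      ← probReal_compl_eq_one_sub (hY.measurable _ measurableSet_Iic)]
    congr 1
    ext ω
    simp [hA]
  have hns : ∀ i, P.real (Y (i, !s) ⁻¹' A (i, !s)) = Real.exp (-1) := fun i ↦ by
    have h3 := hY.cdf_eq (i, !s) 0
    rw [neg_zero, zero_div, Real.exp_zero] at h3
    rw [← h3]
    congr 1
    ext ω
    simp [hA]
  unfold Measure.real at hs hns ⊢
  rw [h2, h1, ENNReal.toReal_prod, Finset.prod_product]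
  have h4 : ∀ i ∈ Finset.range m, ∏ b : Bool, (P (Y (i, b) ⁻¹' A (i, b))).toReal
      = (1 - Real.exp (-Real.exp (-Δ / γ))) * Real.exp (-1) := fun i _ ↦ by
    rw [Fintype.prod_bool, ← hs i, ← hns i]
    cases s
    · exact mul_comm _ _
    · rfl
  rw [Finset.prod_congr rfl h4, Finset.prod_const, Finset.card_range]

/-- Both outcomes have a probability that is bounded below as long as the utilities differ by at
most `Δ`. -/
lemma le_measure_outcome (hY : IsGumbelRow P γ Y) {η Δ a c : ℝ} {m : ℕ} (hm : 1 ≤ m)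
    (hb : boundary η m ≤ m) (hac : |c - a| ≤ Δ) :
    ((1 - Real.exp (-Real.exp (-Δ / γ))) * Real.exp (-1)) ^ m
        ≤ P.real {ω | testOutcome η (noisyAnswers a c (Y · ω)) = 1} ∧
      ((1 - Real.exp (-Real.exp (-Δ / γ))) * Real.exp (-1)) ^ m
        ≤ P.real {ω | testOutcome η (noisyAnswers a c (Y · ω)) = -1} := by
  have hle := abs_le.1 hac
  constructor
  · rw [← hY.measure_unanimous Δ m true]
    refine measureReal_mono fun ω hω ↦ testOutcome_eq_one_of_forall hm hb fun i hi ↦ ?_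
    obtain ⟨h1, h2⟩ := hω i hi
    rw [noisyAnswers_eq_one_iff]
    change Y (i, false) ω ≤ 0 at h2
    linarith
  · rw [← hY.measure_unanimous Δ m false]
    refine measureReal_mono fun ω hω ↦ testOutcome_eq_neg_one_of_forall hm hb fun i hi ↦ ?_
    obtain ⟨h1, h2⟩ := hω i hi
    change Y (i, true) ω ≤ 0 at h2
    refine (noisyAnswers_eq_or a c (Y · ω) i).resolve_left fun h ↦ ?_
    rw [noisyAnswers_eq_one_iff] at h
    linarith

/-- A human with a strict preference answers with a bias. -/
lemma measure_answer_ne_half (hY : IsGumbelRow P γ Y) (hγ : 0 < γ) {a c : ℝ} (hac : a ≠ c) :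
    P.real {ω | noisyAnswers a c (Y · ω) 0 = 1} ≠ 1 / 2 := by
  have hfair : P.real {ω | noisyAnswers 0 0 (Y · ω) 0 = 1} = 1 / 2 := by
    unfold Measure.real
    rw [(hY.measure_fair_answer 0).1]
    simp
  -- a rectangle of noises on which the biased and the fair answer differ
  have hrect : ∀ (s : Bool) (E : ℝ), 0 < E →
      0 < P.real ({ω | Y (0, s) ω ∈ Set.Ioc 0 (E / 2)} ∩ {ω | Y (0, !s) ω ∈ Set.Ioc (E / 2) E}) :=
    fun s E hE ↦ by
      have hind := (hY.indep.indepFun (i := (0, s)) (j := (0, !s))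
        (by simp)).measure_inter_preimage_eq_mul (Set.Ioc 0 (E / 2)) (Set.Ioc (E / 2) E)
        measurableSet_Ioc measurableSet_Ioc
      have h1 := hY.measure_Ioc_pos hγ (0, s) (by linarith : (0 : ℝ) < E / 2)
      have h2 := hY.measure_Ioc_pos hγ (0, !s) (by linarith : E / 2 < E)
      have h3 := congrArg ENNReal.toReal hind
      rw [ENNReal.toReal_mul] at h3
      exact (mul_pos h1 h2).trans_eq h3.symm
  have hms : ∀ a c : ℝ, MeasurableSet {ω | noisyAnswers a c (Y · ω) 0 = 1} := fun a c ↦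
    ((measurable_noisyAnswers_apply a c 0).comp hY.measurable_row) (measurableSet_singleton 1)
  -- the event of the larger bias contains the other one and the rectangle
  have hlt : ∀ (a c a' c' : ℝ) (s : Bool) (E : ℝ), 0 < E →
      (∀ ω, noisyAnswers a c (Y · ω) 0 = 1 → noisyAnswers a' c' (Y · ω) 0 = 1) →
      (∀ ω, Y (0, s) ω ∈ Set.Ioc 0 (E / 2) → Y (0, !s) ω ∈ Set.Ioc (E / 2) E →
        ¬ noisyAnswers a c (Y · ω) 0 = 1 ∧ noisyAnswers a' c' (Y · ω) 0 = 1) →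
      P.real {ω | noisyAnswers a c (Y · ω) 0 = 1}
        < P.real {ω | noisyAnswers a' c' (Y · ω) 0 = 1} := by
    intro a c a' c' s E hE hsub hr
    have h1 := hrect s E hE
    have h2 := measureReal_sdiff (μ := P) (s₁ := {ω | noisyAnswers a' c' (Y · ω) 0 = 1})
      (s₂ := {ω | noisyAnswers a c (Y · ω) 0 = 1}) hsub
      (hms a c)
    have h3 : P.real ({ω | Y (0, s) ω ∈ Set.Ioc 0 (E / 2)} ∩
        {ω | Y (0, !s) ω ∈ Set.Ioc (E / 2) E})
        ≤ P.real ({ω | noisyAnswers a' c' (Y · ω) 0 = 1} \ {ω | noisyAnswers a c (Y · ω) 0 = 1}) :=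
      measureReal_mono fun ω hω ↦ ⟨(hr ω hω.1 hω.2).2, (hr ω hω.1 hω.2).1⟩
    linarith
  rcases lt_or_gt_of_ne hac with h | h
  · refine ne_of_gt (hfair ▸ hlt 0 0 a c true (c - a) (by linarith) ?_ ?_)
    · intro ω hω
      rw [noisyAnswers_eq_one_iff] at hω ⊢
      linarith
    · rintro ω ⟨h1, h2⟩ ⟨h3, h4⟩
      simp only [Bool.not_true] at h3 h4
      rw [noisyAnswers_eq_one_iff, noisyAnswers_eq_one_iff]
      constructor <;> linarith
  · refine ne_of_lt (hfair ▸ hlt a c 0 0 false (a - c) (by linarith) ?_ ?_)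
    · intro ω hω
      rw [noisyAnswers_eq_one_iff] at hω ⊢
      linarith
    · rintro ω ⟨h1, h2⟩ ⟨h3, h4⟩
      simp only [Bool.not_false] at h3 h4
      rw [noisyAnswers_eq_one_iff, noisyAnswers_eq_one_iff]
      constructor <;> linarith

/-- The test almost surely stops when the human has a strict preference, by the strong law of
large numbers. -/
lemma measure_outcome_zero (hY : IsGumbelRow P γ Y) (hγ : 0 < γ) {η a c : ℝ}
    (hη : 0 < η) (hη' : η < 1) (hac : a ≠ c) :
    P {ω | testOutcome η (noisyAnswers a c (Y · ω)) = 0} = 0 := by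
  set z : ℕ → Ω → ℝ := fun i ω ↦ noisyAnswers a c (Y · ω) i with hz
  have hzm : ∀ i, Measurable (z i) := fun i ↦
    (measurable_noisyAnswers_apply a c i).comp hY.measurable_row
  have hpair : Measurable fun q : ℝ × ℝ ↦ if a + q.1 < c + q.2 then (1 : ℝ) else -1 :=
    Measurable.ite (measurableSet_lt (by fun_prop) (by fun_prop)) measurable_const measurable_const
  have hind : Pairwise (Function.onFun (· ⟂ᵢ[P] ·) z) := fun i j hij ↦
    (hY.indep.indepFun_prodMk_prodMk hY.measurable (i, false) (i, true) (j, false) (j, true)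
      (by simp [hij]) (by simp [hij]) (by simp [hij]) (by simp [hij])).comp hpair hpair
  have hident : ∀ i, IdentDistrib (z i) (z 0) P P := fun i ↦
    ((hY.identDistrib (i, false) (0, false)).prodMk (hY.identDistrib (i, true) (0, true))
      (hY.indep.indepFun (by simp)) (hY.indep.indepFun (by simp))).comp hpair
  have hbdd : ∀ ω, ‖z 0 ω‖ ≤ 1 := fun ω ↦ by
    rcases noisyAnswers_eq_or a c (Y · ω) 0 with h | h <;> simp [hz, h]
  have hint : Integrable (z 0) P :=
    Integrable.of_bound (hzm 0).aestronglyMeasurable 1 (Filter.Eventually.of_forall hbdd)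
  have hmean : ∫ ω, z 0 ω ∂P = 2 * P.real {ω | z 0 ω = 1} - 1 := by
    have hE : MeasurableSet {ω | z 0 ω = 1} := hzm 0 (measurableSet_singleton 1)
    have h1 : ∀ ω, z 0 ω = 2 * Set.indicator {ω | z 0 ω = 1} (fun _ ↦ (1 : ℝ)) ω - 1 := fun ω ↦ by
      rcases noisyAnswers_eq_or a c (Y · ω) 0 with h | h
      · have : z 0 ω = 1 := h
        rw [Set.indicator_of_mem (by exact this), this]
        norm_num
      · have : z 0 ω = -1 := h
        rw [Set.indicator_of_notMem (by
          intro h'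
          rw [Set.mem_ofPred_eq, this] at h'
          norm_num at h'), this]
        norm_num
    rw [integral_congr_ae (Filter.Eventually.of_forall h1), integral_sub, integral_const_mul,
      integral_indicator_const _ hE]
    · simp
    · exact ((integrable_const (1 : ℝ)).indicator hE).const_mul 2
    · exact integrable_const _
  have hne : ∫ ω, z 0 ω ∂P ≠ 0 := by
    rw [hmean]
    have := hY.measure_answer_ne_half hγ hac
    intro h
    exact this (by linarith)
  have hlaw := strong_law_ae_real z hint hind hident
  set M := ∫ ω, z 0 ω ∂P
  have hM : 0 < |M| / 2 := by positivity
  refine measure_eq_zero_iff_ae_notMem.2 ?_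
  filter_upwards [hlaw] with ω hω hzero
  have h1 := hω.abs.eventually_const_lt (by linarith : |M| / 2 < |M|)
  obtain ⟨m, hm1, hm2, hm0⟩ := (h1.and ((eventually_boundary_le η hM).and
    (Filter.eventually_ge_atTop 1))).exists
  rcases testOutcome_eq_iff.1 hzero with ⟨n, hn, -, hs⟩ | ⟨hno, -⟩
  · have h2 := boundary_pos hη hη' hn.1
    have h3 := hn.2
    rw [sign_eq_zero_iff.1 hs, abs_zero] at h3
    linarith
  · refine hno m ⟨hm0, ?_⟩
    have hm0' : (0 : ℝ) < m := by exact_mod_cast hm0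
    rw [abs_div, Nat.abs_cast, lt_div_iff₀ hm0'] at hm1
    exact hm2.trans hm1.le

end IsGumbelRow

/-! ### Integration against independent randomness given a countable history -/

/-- If `X` takes countably many values and is independent of the family `G`, then `G (X ω) ω` may be
integrated by first averaging `G x` for fixed `x`. -/
lemma lintegral_comp_eq_of_indep {Ω ι : Type*} [Countable ι] {m₁ m₂ mΩ : MeasurableSpace Ω}
    {P : Measure Ω} (h₁ : m₁ ≤ mΩ) (h₂ : m₂ ≤ mΩ) (hind : Indep m₁ m₂ P) {X : Ω → ι}
    (hX : ∀ x, MeasurableSet[m₁] {ω | X ω = x}) {G : ι → Ω → ENNReal}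
    (hG : ∀ x, Measurable[m₂] (G x)) :
    ∫⁻ ω, G (X ω) ω ∂P = ∫⁻ ω, (∫⁻ ω', G (X ω) ω' ∂P) ∂P := by
  have hsum : ∀ H : ι → Ω → ENNReal, ∀ ω,
      H (X ω) ω = ∑' x, Set.indicator {ω | X ω = x} (1 : Ω → ENNReal) ω * H x ω := fun H ω ↦ by
    rw [tsum_eq_single (X ω)]
    · simp
    · intro x hx
      rw [Set.indicator_of_notMem (show ω ∉ {ω | X ω = x} from fun h ↦ hx h.symm), zero_mul]
  have hm : ∀ x, Measurable[m₁] (Set.indicator {ω | X ω = x} (1 : Ω → ENNReal)) := fun x ↦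
    Measurable.indicator (m := m₁) (@measurable_const ENNReal Ω _ m₁ 1) (hX x)
  have hm' : ∀ x, Measurable (Set.indicator {ω | X ω = x} (1 : Ω → ENNReal)) :=
    fun x ↦ (hm x).mono h₁ le_rfl
  rw [lintegral_congr (hsum G), lintegral_congr (hsum fun x _ ↦ ∫⁻ ω', G x ω' ∂P),
    lintegral_tsum (f := fun x ω ↦ Set.indicator {ω | X ω = x} (1 : Ω → ENNReal) ω * G x ω)
      fun x ↦ ((hm' x).mul ((hG x).mono h₂ le_rfl)).aemeasurable,
    lintegral_tsum (f := fun x ω ↦ Set.indicator {ω | X ω = x} (1 : Ω → ENNReal) ω * _)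
      fun x ↦ ((hm' x).mul measurable_const).aemeasurable]
  refine tsum_congr fun x ↦ ?_
  rw [lintegral_mul_eq_lintegral_mul_lintegral_of_independent_measurableSpace h₁ h₂ hind (hm x)
    (hG x), lintegral_mul_const _ (hm' x)]

/-! ### The process of horizontal moves along histories of signals -/

namespace AlignmentModel

variable {Δ θs : ℝ} (M : AlignmentModel Δ θs)

lemma isDensity_prior : IsDensity M.bound M.prior := by
  have hb := M.bound_pos
  have hint : IntegrableOn M.prior (Set.Icc (-M.bound) M.bound) :=
    (intervalIntegrable_iff_integrableOn_Icc_of_le (by linarith)).1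
      (intervalIntegral.intervalIntegrable_of_integral_ne_zero (by
        rw [M.integral_prior]; exact one_ne_zero))
  refine ⟨hb, fun x hx ↦ (M.prior_pos x hx).le, hint, ?_⟩
  rw [← M.integral_prior, intervalIntegral.integral_of_le (by linarith),
    ← integral_Icc_eq_integral_Ioc]
  unfold mass
  rw [Measure.restrict_univ]

/-- The utilities of the two points compared at `θ` are ordered by the position of `θ`. -/
lemma utility_lt_of_lt {θ : ℝ} (hθ : θ ∈ Set.Icc (-M.bound) M.bound) (h : θ < θs) :
    M.utility (M.cMinus θ) < M.utility (M.cPlus θ) := by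
  have h1 := M.cMinus_lt θ hθ
  have h2 := M.lt_cPlus θ hθ
  unfold utility
  refine neg_lt_neg ?_
  rcases le_or_gt (M.cPlus θ) θs with h3 | h3
  · exact M.dist_spec.lt_of_left _ _ _ (h1.trans h2) h3
  · calc M.dist (M.cPlus θ) θs = M.dist θs (M.cPlus θ) := M.dist_spec.symm _ _
      _ < M.dist θ (M.cPlus θ) := M.dist_spec.lt_of_left _ _ _ h h3.le
      _ = M.dist (M.cMinus θ) θ := by
        rw [M.dist_spec.symm, M.dist_cPlus θ hθ, M.dist_cMinus θ hθ]
      _ = M.dist θ (M.cMinus θ) := M.dist_spec.symm _ _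
      _ < M.dist θs (M.cMinus θ) := M.dist_spec.lt_of_right _ _ _ h1.le h
      _ = M.dist (M.cMinus θ) θs := M.dist_spec.symm _ _

lemma utility_gt_of_gt {θ : ℝ} (hθ : θ ∈ Set.Icc (-M.bound) M.bound) (h : θs < θ) :
    M.utility (M.cPlus θ) < M.utility (M.cMinus θ) := by
  have h1 := M.cMinus_lt θ hθ
  have h2 := M.lt_cPlus θ hθ
  unfold utility
  refine neg_lt_neg ?_
  rcases le_or_gt θs (M.cMinus θ) with h3 | h3
  · exact M.dist_spec.lt_of_right _ _ _ h3 (h1.trans h2)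
  · calc M.dist (M.cMinus θ) θs = M.dist θs (M.cMinus θ) := M.dist_spec.symm _ _
      _ < M.dist θ (M.cMinus θ) := M.dist_spec.lt_of_right _ _ _ h3.le h
      _ = M.dist (M.cPlus θ) θ := by
        rw [M.dist_spec.symm, M.dist_cMinus θ hθ, M.dist_cPlus θ hθ]
      _ = M.dist θ (M.cPlus θ) := M.dist_spec.symm _ _
      _ < M.dist θs (M.cPlus θ) := M.dist_spec.lt_of_left _ _ _ h h2.le
      _ = M.dist (M.cPlus θ) θs := M.dist_spec.symm _ _

lemma utility_eq_of_eq : M.utility (M.cMinus θs) = M.utility (M.cPlus θs) := by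
  unfold utility
  rw [M.dist_cMinus θs M.mem_range, M.dist_cPlus θs M.mem_range]

lemma abs_utility_sub_le {θ : ℝ} (hθ : θ ∈ Set.Icc (-M.bound) M.bound) :
    |M.utility (M.cPlus θ) - M.utility (M.cMinus θ)| ≤ Δ := by
  have hc : M.dist (M.cPlus θ) (M.cMinus θ) ≤ Δ := by
    have h1 := M.dist_spec.triangle (M.cPlus θ) θ (M.cMinus θ)
    rw [M.dist_spec.symm θ, M.dist_cPlus θ hθ, M.dist_cMinus θ hθ] at h1
    linarith
  have h1 := M.dist_spec.triangle (M.cPlus θ) (M.cMinus θ) θs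
  have h2 := M.dist_spec.triangle (M.cMinus θ) (M.cPlus θ) θs
  rw [M.dist_spec.symm (M.cMinus θ) (M.cPlus θ)] at h2
  unfold utility
  rw [abs_le]
  constructor <;> linarith

/-- The state reached by a list of signals, the latest one at the head. -/
noncomputable def stateAfter (p : ℝ) : List SignType → State
  | [] => ⟨M.prior, true⟩
  | z :: l => (stateAfter p l).move p (median M.bound (stateAfter p l).density) z

lemma isDensity_stateAfter {p : ℝ} (hp0 : 0 < p) (hp1 : p < 1) (l : List SignType) :
    IsDensity M.bound (M.stateAfter p l).density := by
  induction l with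
  | nil => exact M.isDensity_prior
  | cons z l ih => exact State.isDensity_move z hp0 hp1 ih

lemma mass_near_stateAfter_pos {p : ℝ} (hp0 : 0 < p) (hp1 : p < 1) (S : Side θs)
    (h : 0 < mass M.bound M.prior S.near) (l : List SignType) :
    0 < mass M.bound (M.stateAfter p l).density S.near := by
  induction l with
  | nil => exact h
  | cons z l ih =>
    exact State.mass_near_move_pos S z hp0 hp1 (M.isDensity_stateAfter hp0 hp1 l) ih

variable {Ω : Type*}

/-- The outcome of the `k`-th test if it is carried out at `θ`. -/
noncomputable def outcome (η : ℝ) (ξ : ℕ → ℕ → Bool → Ω → ℝ) (k : ℕ) (θ : ℝ) (ω : Ω) : SignType :=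
  testOutcome η fun i ↦ M.answer θ (ξ k i true ω) (ξ k i false ω)

/-- The signals of the first `k` moves, the latest one at the head. -/
noncomputable def history (p η : ℝ) (ξ : ℕ → ℕ → Bool → Ω → ℝ) : ℕ → Ω → List SignType
  | 0, _ => []
  | k + 1, ω => M.outcome η ξ k
      (median M.bound (M.stateAfter p (history p η ξ k ω)).density) ω :: history p η ξ k ω

lemma state_eq_stateAfter (p η : ℝ) (ξ : ℕ → ℕ → Bool → Ω → ℝ) (ω : Ω) (k : ℕ) :
    M.state p η ξ ω k = M.stateAfter p (M.history p η ξ k ω) := by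
  induction k with
  | zero => rfl
  | succ k ih =>
    rw [state, ih]
    rfl

lemma query_eq (p η : ℝ) (ξ : ℕ → ℕ → Bool → Ω → ℝ) (ω : Ω) (k : ℕ) : M.query p η ξ k ω
    = median M.bound (M.stateAfter p (M.history p η ξ k ω)).density := by
  rw [query, state_eq_stateAfter]

lemma query_mem {p : ℝ} (hp0 : 0 < p) (hp1 : p < 1) (η : ℝ) (ξ : ℕ → ℕ → Bool → Ω → ℝ)
    (k : ℕ) (ω : Ω) : M.query p η ξ k ω ∈ Set.Icc (-M.bound) M.bound := by
  rw [query_eq]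
  exact (M.isDensity_stateAfter hp0 hp1 _).median_spec.1

/-- The information in the noise variables with index in `T`. -/
abbrev noiseInfo (ξ : ℕ → ℕ → Bool → Ω → ℝ) (T : Set (ℕ × ℕ × Bool)) : MeasurableSpace Ω :=
  ⨆ j ∈ T, MeasurableSpace.comap (ξ j.1 j.2.1 j.2.2) inferInstance

lemma measurableSet_outcome (η : ℝ) (ξ : ℕ → ℕ → Bool → Ω → ℝ) {T : Set (ℕ × ℕ × Bool)} {k : ℕ}
    (hT : ∀ j, j.1 = k → j ∈ T) (θ : ℝ) (z : SignType) :
    MeasurableSet[noiseInfo ξ T] {ω | M.outcome η ξ k θ ω = z} := by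
  have h1 : ∀ j : ℕ × Bool, Measurable[noiseInfo ξ T] (ξ k j.1 j.2) := fun j ↦
    Measurable.of_comap_le (le_biSup
      (f := fun j : ℕ × ℕ × Bool ↦ MeasurableSpace.comap (ξ j.1 j.2.1 j.2.2) inferInstance)
      (hT (k, j) rfl))
  have h2 : Measurable[noiseInfo ξ T] fun ω (j : ℕ × Bool) ↦ ξ k j.1 j.2 ω :=
    @measurable_pi_lambda _ _ _ (noiseInfo ξ T) _ _ h1
  exact h2 (measurableSet_outcomeSet η _ _ z)

lemma measurableSet_history (p η : ℝ) (ξ : ℕ → ℕ → Bool → Ω → ℝ) {T : Set (ℕ × ℕ × Bool)}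
    {k : ℕ} (hT : ∀ j, j.1 < k → j ∈ T) (l : List SignType) :
    MeasurableSet[noiseInfo ξ T] {ω | M.history p η ξ k ω = l} := by
  induction k generalizing l with
  | zero => exact @MeasurableSet.const Ω (noiseInfo ξ T) ([] = l)
  | succ k ih =>
    cases l with
    | nil =>
      rw [show {ω | M.history p η ξ (k + 1) ω = []} = ∅ from
        Set.eq_empty_of_forall_notMem fun ω h ↦ List.cons_ne_nil _ _ h]
      exact @MeasurableSet.empty _ (noiseInfo ξ T)
    | cons z l =>
      have : {ω | M.history p η ξ (k + 1) ω = z :: l} = {ω | M.history p η ξ k ω = l} ∩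
          {ω | M.outcome η ξ k (median M.bound (M.stateAfter p l).density) ω = z} := by
        ext ω
        change _ :: _ = _ ↔ _ = l ∧ _ = z
        rw [List.cons_eq_cons]
        constructor
        · rintro ⟨h1, h2⟩
          exact ⟨h2, h2 ▸ h1⟩
        · rintro ⟨h1, h2⟩
          exact ⟨h1.symm ▸ h2, h1⟩
      rw [this]
      exact @MeasurableSet.inter _ (noiseInfo ξ T) _ _ (ih (fun j hj ↦ hT j (by omega)) l)
        (M.measurableSet_outcome η ξ (fun j hj ↦ hT j (by omega)) _ z)

variable [mΩ : MeasurableSpace Ω] {P : Measure Ω} {γ : ℝ} {ξ : ℕ → ℕ → Bool → Ω → ℝ}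

lemma noiseInfo_le (hξ : IsGumbelNoise P γ ξ) (T : Set (ℕ × ℕ × Bool)) : noiseInfo ξ T ≤ mΩ :=
  iSup₂_le fun j _ ↦ (hξ.measurable j.1 j.2.1 j.2.2).comap_le

lemma measurable_comp_history {β : Type*} [MeasurableSpace β] (hξ : IsGumbelNoise P γ ξ)
    (p η : ℝ) (k : ℕ) (f : List SignType → β) :
    Measurable fun ω ↦ f (M.history p η ξ k ω) := by
  let _ : MeasurableSpace (List SignType) := ⊤
  have h : Measurable (M.history p η ξ k) := measurable_to_countable' fun l ↦
    noiseInfo_le hξ Set.univ _ (M.measurableSet_history p η ξ (fun _ _ ↦ Set.mem_univ _) l)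
  exact measurable_from_top.comp h

/-- The potential of the side `S` after the signals `l`. A stopped process has potential `0` when it
stopped at the target, and `⊤` on the null event that it stopped elsewhere. -/
noncomputable def sidePotential (p σ τ : ℝ) (S : Side θs) (l : List SignType) : ENNReal :=
  open Classical in
  if (M.stateAfter p l).running = true then
    ENNReal.ofReal (S.potentialOf p σ τ M.bound (M.stateAfter p l).density)
  else if median M.bound (M.stateAfter p l).density = θs then 0 else ⊤

/-- The conditional mean of the potential contracts by the factor `r` in every move. -/
lemma lintegral_sidePotential_cons_le [IsProbabilityMeasure P] (hξ : IsGumbelNoise P γ ξ)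
    {p η κ σ τ r₁ r : ℝ} {m : ℕ} (hη : 0 < η) (hη' : η < 1) (hp : 1 / 2 < p)
    (hp' : p < 1 - η / 2) (hγ : 0 < γ) (hc : StepConstants p (η / 2) κ σ τ r₁ r)
    (hm : 1 ≤ m) (hb : boundary η m ≤ m)
    (hκ : κ ≤ ((1 - Real.exp (-Real.exp (-Δ / γ))) * Real.exp (-1)) ^ m) (S : Side θs)
    (hS : 0 < mass M.bound M.prior S.near) (k : ℕ) (l : List SignType) :
    ∫⁻ ω, M.sidePotential p σ τ S
        (M.outcome η ξ k (median M.bound (M.stateAfter p l).density) ω :: l) ∂P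
      ≤ ENNReal.ofReal r * M.sidePotential p σ τ S l := by
  have hp1 : p < 1 := by linarith
  have hp0 : 0 < p := by linarith
  have hρ := M.isDensity_stateAfter hp0 hp1 l
  have hpos := M.mass_near_stateAfter_pos hp0 hp1 S hS l
  set s := M.stateAfter p l with hs
  set θ := median M.bound s.density with hθ
  have hcons : ∀ z, M.stateAfter p (z :: l) = s.move p θ z := fun z ↦ rfl
  by_cases hrun : s.running = true
  swap
  · -- a stopped process keeps its potential, which is `0` or `⊤`
    have hrun' : s.running = false := by simpa using hrun
    have hval : ∀ z, M.sidePotential p σ τ S (z :: l) = if θ = θs then 0 else ⊤ := fun z ↦ by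
      unfold sidePotential
      rw [hcons, State.move_stopped (Or.inl hrun'), if_neg (by simp)]
    have hval' : M.sidePotential p σ τ S l = if θ = θs then 0 else ⊤ := by
      unfold sidePotential
      rw [if_neg hrun]
    simp_rw [hval, hval']
    split_ifs
    · simp
    · rw [ENNReal.mul_top (by simpa using hc.l_pos)]
      exact le_top
  have hY := hξ.row k
  have hθm := hρ.median_spec.1
  set a := M.utility (M.cMinus θ) with ha
  set c := M.utility (M.cPlus θ) with hc'
  set O : SignType → Set Ω := fun z ↦ {ω | M.outcome η ξ k θ ω = z} with hO
  have hOm : ∀ z, MeasurableSet (O z) := fun z ↦ hY.measurableSet_outcome η a c z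
  -- the facts about the test at `θ`
  have hwrong : ∀ z, PointsTo θs θ z → P.real (O (-z)) ≤ η / 2 := by
    rintro z (⟨rfl, h⟩ | ⟨rfl, h⟩)
    · refine hY.measure_outcome_neg_one_le hη hη' ?_
      rcases h.eq_or_lt with h | h
      · rw [h]; exact M.utility_eq_of_eq.le
      · exact (M.utility_lt_of_lt hθm h).le
    · rw [neg_neg]
      refine hY.measure_outcome_one_le hη hη' ?_
      rcases h.eq_or_lt with h | h
      · rw [← h]; exact M.utility_eq_of_eq.ge
      · exact (M.utility_gt_of_gt hθm h).le
  have hlow := hY.le_measure_outcome (η := η) hm hb (M.abs_utility_sub_le hθm)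
  have hzero : θ ≠ θs → P (O 0) = 0 := fun hne ↦ by
    refine hY.measure_outcome_zero hγ hη hη' ?_
    rcases lt_or_gt_of_ne hne with h | h
    · exact (M.utility_lt_of_lt hθm h).ne
    · exact (M.utility_gt_of_gt hθm h).ne'
  have hdisj : ∀ z z', z ≠ z' → Disjoint (O z) (O z') := fun z z' hzz ↦
    Set.disjoint_left.2 fun ω (h1 : _ = z) (h2 : _ = z') ↦ hzz (h1.symm.trans h2)
  have hne : S.toward ≠ -S.toward := by
    rcases S.toward_beyond with h | h <;> rw [h.1] <;> decide
  have hud : P.real (O S.toward) + P.real (O (-S.toward)) ≤ 1 := by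
    rw [← measureReal_union (hdisj _ _ hne) (hOm _)]
    exact measureReal_le_one
  have hu : κ ≤ P.real (O S.toward) := by
    refine hκ.trans ?_
    rcases S.toward_beyond with h | h <;> rw [h.1]
    · exact hlow.1
    · exact hlow.2
  have hstep := hc.potentialOf_step hp hp1 (by linarith) S hrun hρ hpos
    (u := P.real (O S.toward)) (d := P.real (O (-S.toward))) measureReal_nonneg measureReal_nonneg
    hud (by linarith) (hwrong S.toward) (fun h ↦ by simpa using hwrong _ h)
  -- decomposition according to the outcome of the test
  have hdecomp : ∀ ω, M.sidePotential p σ τ S (M.outcome η ξ k θ ω :: l)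
      ≤ (O S.toward).indicator (fun _ ↦ M.sidePotential p σ τ S (S.toward :: l)) ω
        + (O (-S.toward)).indicator (fun _ ↦ M.sidePotential p σ τ S (-S.toward :: l)) ω
        + (O 0).indicator (fun _ ↦ M.sidePotential p σ τ S (0 :: l)) ω := fun ω ↦ by
    have hcases : ∀ z : SignType, z = S.toward ∨ z = -S.toward ∨ z = 0 := by
      rcases S.toward_beyond with h | h <;> rw [h.1] <;> decide
    rcases hcases (M.outcome η ξ k θ ω) with h | h | h
    · rw [Set.indicator_of_mem (show ω ∈ O S.toward from h), h, add_assoc]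
      exact le_self_add
    · rw [Set.indicator_of_mem (show ω ∈ O (-S.toward) from h), h]
      exact le_add_self.trans le_self_add
    · rw [Set.indicator_of_mem (show ω ∈ O 0 from h), h]
      exact le_add_self
  have hhalted : M.sidePotential p σ τ S (0 :: l) * P (O 0) = 0 := by
    unfold sidePotential
    rw [hcons, State.move_stopped (Or.inr rfl), if_neg (by simp)]
    change (if θ = θs then 0 else ⊤) * P (O 0) = 0
    split_ifs with h
    · exact zero_mul _
    · rw [hzero h, mul_zero]
  have hmoved : ∀ z, z ≠ 0 → M.sidePotential p σ τ S (z :: l)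
      = ENNReal.ofReal (S.potentialOf p σ τ M.bound (s.move p θ z).density) := fun z hz ↦ by
    unfold sidePotential
    rw [hcons, if_pos (State.move_running hrun hz)]
  have hnow : M.sidePotential p σ τ S l
      = ENNReal.ofReal (S.potentialOf p σ τ M.bound s.density) := by
    unfold sidePotential
    rw [if_pos hrun]
  have hnonneg : ∀ z, 0 ≤ S.potentialOf p σ τ M.bound (s.move p θ z).density := fun z ↦
    hc.potential_nonneg (State.mass_near_move_pos S z hp0 hp1 hρ hpos)
      ((State.isDensity_move z hp0 hp1 hρ).mass_nonneg _)
  have hofReal : ∀ z, P (O z) = ENNReal.ofReal (P.real (O z)) :=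
    fun z ↦ (ofReal_measureReal (measure_ne_top P _)).symm
  calc ∫⁻ ω, M.sidePotential p σ τ S (M.outcome η ξ k θ ω :: l) ∂P
      ≤ _ := lintegral_mono hdecomp
    _ = M.sidePotential p σ τ S (S.toward :: l) * P (O S.toward)
        + M.sidePotential p σ τ S (-S.toward :: l) * P (O (-S.toward)) := by
        rw [lintegral_add_right _ (measurable_const.indicator (hOm _)),
          lintegral_add_right _ (measurable_const.indicator (hOm _)),
          lintegral_indicator_const (hOm _), lintegral_indicator_const (hOm _),
          lintegral_indicator_const (hOm _), hhalted, add_zero]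
    _ = ENNReal.ofReal (P.real (O S.toward)
          * S.potentialOf p σ τ M.bound (s.move p θ S.toward).density
        + P.real (O (-S.toward))
          * S.potentialOf p σ τ M.bound (s.move p θ (-S.toward)).density) := by
        rw [hmoved _ S.toward_ne_zero, hmoved _ S.neg_toward_ne_zero, hofReal, hofReal,
          ENNReal.ofReal_add (mul_nonneg measureReal_nonneg (hnonneg _))
            (mul_nonneg measureReal_nonneg (hnonneg _)),
          ENNReal.ofReal_mul measureReal_nonneg, ENNReal.ofReal_mul measureReal_nonneg,
          mul_comm, mul_comm (ENNReal.ofReal (S.potentialOf p σ τ M.bound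
            (s.move p θ (-S.toward)).density))]
    _ ≤ ENNReal.ofReal r * M.sidePotential p σ τ S l := by
        rw [hnow, ← ENNReal.ofReal_mul hc.l_pos.le]
        exact ENNReal.ofReal_le_ofReal hstep

/-- The query point lies in the far part of a side with exponentially small probability. -/
lemma measure_query_mem_far_le [IsProbabilityMeasure P] (hξ : IsGumbelNoise P γ ξ)
    {p η κ σ τ r₁ r e : ℝ} {m : ℕ} (hη : 0 < η) (hη' : η < 1) (hp : 1 / 2 < p)
    (hp' : p < 1 - η / 2) (hγ : 0 < γ) (hc : StepConstants p (η / 2) κ σ τ r₁ r)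
    (hm : 1 ≤ m) (hb : boundary η m ≤ m)
    (hκ : κ ≤ ((1 - Real.exp (-Real.exp (-Δ / γ))) * Real.exp (-1)) ^ m) (S : Side θs)
    (he : 0 < e) (hS : e ≤ mass M.bound M.prior S.near) (k : ℕ) :
    P.real {ω | M.query p η ξ k ω ∈ S.far} ≤ r ^ k * ((1 + σ + τ) / e ^ 2) := by
  have hp1 : p < 1 := by linarith
  have hp0 : 0 < p := by linarith
  have hS0 : 0 < mass M.bound M.prior S.near := he.trans_le hS
  have he1 : e ≤ 1 := hS.trans (M.isDensity_prior.mass_le_one S.near_meas)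
  set f := M.sidePotential p σ τ S with hf
  have hdecay : ∀ k, ∫⁻ ω, f (M.history p η ξ k ω) ∂P
      ≤ ENNReal.ofReal (r ^ k * ((1 + σ + τ) / e ^ 2)) := by
    intro k
    induction k with
    | zero =>
      have h0 : ∀ ω, f (M.history p η ξ 0 ω)
          = ENNReal.ofReal (S.potentialOf p σ τ M.bound M.prior) := fun ω ↦ rfl
      rw [lintegral_congr h0, lintegral_const, measure_univ, mul_one, pow_zero, one_mul]
      exact ENNReal.ofReal_le_ofReal
        (hc.potential_le hp hp1 he he1 hS (M.isDensity_prior.mass_nonneg _))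
    | succ k ih =>
      have hind : Indep (noiseInfo ξ {j | j.1 < k}) (noiseInfo ξ {j | j.1 = k}) P :=
        indep_iSup_of_disjoint
          (m := fun j : ℕ × ℕ × Bool ↦ MeasurableSpace.comap (ξ j.1 j.2.1 j.2.2) inferInstance)
          (fun j ↦ (hξ.measurable j.1 j.2.1 j.2.2).comap_le) hξ.indep
          (Set.disjoint_left.2 fun j (h1 : j.1 < k) (h2 : j.1 = k) ↦ by omega)
      have hmeas : ∀ l, Measurable[noiseInfo ξ {j | j.1 = k}] fun ω ↦ f (M.outcome η ξ k
          (median M.bound (M.stateAfter p l).density) ω :: l) := fun l ↦ by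
        let _ : MeasurableSpace SignType := ⊤
        have ho : Measurable[noiseInfo ξ {j | j.1 = k}]
            (M.outcome η ξ k (median M.bound (M.stateAfter p l).density)) :=
          @measurable_to_countable' SignType Ω _ _ (noiseInfo ξ {j | j.1 = k}) _ fun z ↦
            M.measurableSet_outcome η ξ (fun j hj ↦ hj) _ z
        exact (measurable_from_top (f := fun z ↦ f (z :: l))).comp ho
      calc ∫⁻ ω, f (M.history p η ξ (k + 1) ω) ∂P
          = ∫⁻ ω, (∫⁻ ω', f (M.outcome η ξ k (median M.bound
              (M.stateAfter p (M.history p η ξ k ω)).density) ω' :: M.history p η ξ k ω) ∂P) ∂P :=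
            lintegral_comp_eq_of_indep (noiseInfo_le hξ _) (noiseInfo_le hξ _) hind
              (M.measurableSet_history p η ξ fun j hj ↦ hj) hmeas
        _ ≤ ∫⁻ ω, ENNReal.ofReal r * f (M.history p η ξ k ω) ∂P :=
            lintegral_mono fun ω ↦ M.lintegral_sidePotential_cons_le hξ hη hη' hp hp' hγ hc hm hb
              hκ S hS0 k _
        _ = ENNReal.ofReal r * ∫⁻ ω, f (M.history p η ξ k ω) ∂P :=
            lintegral_const_mul _ (M.measurable_comp_history hξ p η k f)
        _ ≤ ENNReal.ofReal r * ENNReal.ofReal (r ^ k * ((1 + σ + τ) / e ^ 2)) :=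
            mul_le_mul_right ih _
        _ = ENNReal.ofReal (r ^ (k + 1) * ((1 + σ + τ) / e ^ 2)) := by
            rw [← ENNReal.ofReal_mul hc.l_pos.le, pow_succ]
            congr 1
            ring
  have hfar : ∀ l, median M.bound (M.stateAfter p l).density ∈ S.far → 1 ≤ f l := fun l hl ↦ by
    rw [hf]
    unfold sidePotential
    split_ifs with h1 h2
    · rw [ENNReal.one_le_ofReal]
      exact hc.one_le_potentialOf S (M.isDensity_stateAfter hp0 hp1 l)
        (M.mass_near_stateAfter_pos hp0 hp1 S hS0 l) hl
    · rw [h2] at hl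
      exact absurd hl S.target_notMem
    · exact le_top
  have hmarkov : P {ω | M.query p η ξ k ω ∈ S.far}
      ≤ ENNReal.ofReal (r ^ k * ((1 + σ + τ) / e ^ 2)) := by
    have h1 := mul_meas_ge_le_lintegral (μ := P) (M.measurable_comp_history hξ p η k f) 1
    rw [one_mul] at h1
    refine (measure_mono fun ω hω ↦ ?_).trans (h1.trans (hdecay k))
    rw [Set.mem_ofPred_eq, query_eq] at hω
    exact hfar _ hω
  have hnonneg : 0 ≤ r ^ k * ((1 + σ + τ) / e ^ 2) := by
    have := hc.l_pos
    have := hc.σ_pos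
    have := hc.τ_pos
    positivity
  exact ENNReal.toReal_le_of_le_ofReal hnonneg hmarkov

lemma mass_Ico_eq {x y : ℝ} (hx : -M.bound ≤ x) (hxy : x ≤ y) (hy : y ≤ M.bound) :
    mass M.bound M.prior (Set.Ico x y) = ∫ t in x..y, M.prior t := by
  unfold mass
  rw [Measure.restrict_restrict measurableSet_Ico, intervalIntegral.integral_of_le hxy,
    ← integral_Ico_eq_integral_Ioc]
  congr 2
  refine Set.inter_eq_left.2 fun t ht ↦ ⟨hx.trans ht.1, ht.2.le.trans hy⟩

end AlignmentModel

/-- Exponential concentration of the query point: the constants `K` and `c` depend only on the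
parameters of the noise and of the update. -/
lemma exists_rate {p η γ : ℝ} (Δ : ℝ) (hη : 0 < η) (hη' : η < 1) (hp : 1 / 2 < p)
    (hp' : p < 1 - η / 2) (hγ : 0 < γ) : ∃ K c : ℝ, 0 < K ∧ 0 < c ∧
    ∀ (θs : ℝ) (M : AlignmentModel Δ θs) (ς ε : ℝ), 0 < ε → M.PriorAssumption ς ε →
    ∀ (Ω : Type*) [MeasurableSpace Ω] (P : Measure Ω) [IsProbabilityMeasure P]
      (ξ : ℕ → ℕ → Bool → Ω → ℝ), IsGumbelNoise P γ ξ → ∀ k : ℕ,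
      1 - (if ε ^ ς ≤ 1 then 2 * K * Real.exp (-(c * k)) / (ε ^ ς) ^ 2 else 0)
        ≤ P.real {ω | |M.query p η ξ k ω - θs| ≤ ε} := by
  have hp1 : p < 1 := by linarith
  have hp0 : 0 < p := by linarith
  obtain ⟨m, hb, hm⟩ := ((eventually_boundary_le η one_pos).and
    (Filter.eventually_ge_atTop 1)).exists
  rw [one_mul] at hb
  set κ := ((1 - Real.exp (-Real.exp (-Δ / γ))) * Real.exp (-1)) ^ m with hκ
  have hbase : 0 < (1 - Real.exp (-Real.exp (-Δ / γ))) ∧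
      (1 - Real.exp (-Real.exp (-Δ / γ))) ≤ 1 := by
    have h1 : Real.exp (-Real.exp (-Δ / γ)) < 1 := by
      rw [Real.exp_lt_one_iff, neg_lt_zero]
      exact Real.exp_pos _
    have h2 := Real.exp_pos (-Real.exp (-Δ / γ))
    constructor <;> linarith
  have hκ0 : 0 < κ := pow_pos (mul_pos hbase.1 (Real.exp_pos _)) m
  have hκ1 : κ ≤ 1 := pow_le_one₀ (mul_pos hbase.1 (Real.exp_pos _)).le
    (mul_le_one₀ hbase.2 (Real.exp_pos _).le (Real.exp_le_one_iff.2 (by norm_num)))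
  obtain ⟨σ, τ, r₁, r, hc⟩ := exists_stepConstants hp hp1 (by linarith : η / 2 < 1 - p) hκ0 hκ1
  have hσ := hc.σ_pos
  have hτ := hc.τ_pos
  refine ⟨1 + σ + τ, -Real.log r, by linarith, by linarith [Real.log_neg hc.l_pos hc.l_lt], ?_⟩
  intro θs M ς ε hε hprior Ω _ P _ ξ hξ k
  have hexp : Real.exp (-(-Real.log r * k)) = r ^ k := by
    rw [neg_mul, neg_neg, mul_comm, Real.exp_nat_mul, Real.exp_log hc.l_pos]
  rw [hexp]
  set e := ε ^ ς with he
  have he0 : 0 < e := Real.rpow_pos_of_pos hε ς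
  set B := if e ≤ 1 then r ^ k * ((1 + σ + τ) / e ^ 2) else 0 with hB
  have hB0 : 0 ≤ B := by
    have := hc.l_pos
    rw [hB]
    split_ifs <;> positivity
  have hside : ∀ S : Side θs, e ≤ mass M.bound M.prior S.near →
      P.real {ω | M.query p η ξ k ω ∈ S.far} ≤ B := fun S hS ↦ by
    have he1 : e ≤ 1 := hS.trans (M.isDensity_prior.mass_le_one S.near_meas)
    rw [hB, if_pos he1]
    exact M.measure_query_mem_far_le hξ hη hη' hp hp' hγ hc hm hb le_rfl S he0 hS k
  -- a side on which the parameter range does not reach beyond `ε` cannot cause an error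
  have hmem := M.mem_range
  have habove : P.real {ω | θs + ε < M.query p η ξ k ω} ≤ B := by
    rcases lt_or_ge ε (M.bound - θs) with h | h
    · refine le_trans (measureReal_mono fun ω hω ↦ ?_) (hside (Side.above θs hε) ?_)
      · exact le_of_lt (show θs + ε < M.query p η ξ k ω from hω)
      · exact (hprior.2 h).trans_eq
          (M.mass_Ico_eq hmem.1 (by linarith) (by linarith)).symm
    · rw [show {ω | θs + ε < M.query p η ξ k ω} = ∅ from Set.eq_empty_of_forall_notMem
        fun ω (hω : θs + ε < M.query p η ξ k ω) ↦ by
          linarith [(M.query_mem hp0 hp1 η ξ k ω).2], measureReal_empty]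
      exact hB0
  have hbelow : P.real {ω | M.query p η ξ k ω < θs - ε} ≤ B := by
    rcases lt_or_ge ε (θs + M.bound) with h | h
    · exact hside (Side.below θs hε) ((hprior.1 h).trans_eq
          (M.mass_Ico_eq (by linarith) (by linarith) hmem.2).symm)
    · rw [show {ω | M.query p η ξ k ω < θs - ε} = ∅ from Set.eq_empty_of_forall_notMem
        fun ω (hω : M.query p η ξ k ω < θs - ε) ↦ by
          linarith [(M.query_mem hp0 hp1 η ξ k ω).1], measureReal_empty]
      exact hB0
  have hgood : MeasurableSet {ω | |M.query p η ξ k ω - θs| ≤ ε} := by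
    have h := M.measurable_comp_history hξ p η k
      fun l ↦ |median M.bound (M.stateAfter p l).density - θs|
    simp_rw [M.query_eq]
    exact measurableSet_le h measurable_const
  have hcompl : {ω | |M.query p η ξ k ω - θs| ≤ ε}ᶜ
      ⊆ {ω | θs + ε < M.query p η ξ k ω} ∪ {ω | M.query p η ξ k ω < θs - ε} := fun ω hω ↦ by
    rw [Set.mem_compl_iff, Set.mem_ofPred_eq, abs_le, not_and_or, not_le, not_le] at hω
    rcases hω with h | h
    · exact Or.inr (show M.query p η ξ k ω < θs - ε by linarith)
    · exact Or.inl (show θs + ε < M.query p η ξ k ω by linarith)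
  have h1 := (measureReal_mono (μ := P) hcompl).trans (measureReal_union_le _ _)
  rw [probReal_compl_eq_one_sub hgood] at h1
  have h2 : 2 * B = if e ≤ 1 then 2 * (1 + σ + τ) * r ^ k / e ^ 2 else 0 := by
    rw [hB]
    split_ifs <;> ring
  rw [← h2]
  linarith

/-! ### The number of moves -/

/-- The thresholds on the number `k` of moves that come from the radius and from the confidence
level together bring the exponential bound below the confidence level. -/
lemma exp_bound_lt {K c t β δ e k : ℝ} (hK : 0 < K) (ht : 0 < t) (hδ : 0 < δ) (hδ1 : δ < 1)
    (he : 0 < e) (hβ : β = (2 * K) ^ 2 / (8 * (8 * t) ^ 4))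
    (h1 : 4 * Real.log (8 * t / (δ * e)) ≤ c * k) (h2 : Real.log (8 * β / δ) ≤ c * k) :
    2 * K * Real.exp (-(c * k)) / e ^ 2 < δ := by
  have hβ' : 8 * β / δ = (2 * K) ^ 2 / (8 * t) ^ 4 / δ := by
    rw [hβ]
    field_simp
  rw [Real.log_div (by positivity) (by positivity), Real.log_mul hδ.ne' he.ne'] at h1
  rw [hβ', Real.log_div (by positivity) hδ.ne', Real.log_div (by positivity) (by positivity),
    Real.log_pow, Real.log_pow] at h2
  push_cast at h2
  have hlδ := Real.log_neg hδ hδ1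
  rw [div_lt_iff₀ (by positivity), ← Real.exp_log (by positivity : 0 < 2 * K), ← Real.exp_add,
    ← Real.exp_log (by positivity : 0 < δ * e ^ 2), Real.exp_lt_exp,
    Real.log_mul hδ.ne' (by positivity), Real.log_pow]
  push_cast
  linarith

/-- The two threshold terms imply the desired precision. -/
lemma AlignmentModel.reachesPrecision_of_rate.{u} {Δ θs p η γ K c t β δ ε ς r₁ r₂ α w : ℝ}
    (M : AlignmentModel Δ θs) (hK : 0 < K) (hc : 0 < c)
    (hrate : ∀ (Ω : Type u) [MeasurableSpace Ω] (P : Measure Ω) [IsProbabilityMeasure P]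
      (ξ : ℕ → ℕ → Bool → Ω → ℝ), IsGumbelNoise P γ ξ → ∀ k : ℕ,
      1 - (if ε ^ ς ≤ 1 then 2 * K * Real.exp (-(c * k)) / (ε ^ ς) ^ 2 else 0)
        ≤ P.real {ω | |M.query p η ξ k ω - θs| ≤ ε})
    (ht : 0 < t) (hδ : 0 < δ) (hδ1 : δ < 1) (hε : 0 < ε)
    (hβ : β = (2 * K) ^ 2 / (8 * (8 * t) ^ 4))
    (hw : ε ^ ς ≤ 1 → 4 * Real.log (8 * t / (δ * ε ^ ς)) / c
      ≤ 4 * w * Real.log (8 * t / (δ * ε ^ ς)) / (r₂ * α)) :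
    AlignmentModel.ReachesPrecision.{u} M p η γ δ ε (horizontalMoves w t r₁ r₂ α c β ς δ ε) := by
  intro Ω _ P _ ξ hξ k hk
  refine lt_of_lt_of_le ?_ (hrate Ω P ξ hξ k)
  split_ifs with he
  · have h1 : 4 * Real.log (8 * t / (δ * ε ^ ς)) / c ≤ k :=
      (hw he).trans ((le_max_left _ _).trans hk)
    have h2 : Real.log (8 * β / δ) / c ≤ k :=
      ((le_max_right _ _).trans (le_max_right _ _)).trans hk
    rw [div_le_iff₀' hc] at h1 h2
    linarith [exp_bound_lt hK ht hδ hδ1 (Real.rpow_pos_of_pos hε ς) hβ h1 h2]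
  · linarith

lemma horizontalMoves_le {t r₁ r₂ α rR β : ℝ} (ht : 0 < t) (hr₁ : 0 < r₁) (hr₂ : 0 < r₂)
    (hα : 0 < α) (hrR : 0 < rR) (hβ : 0 < β) : ∃ C : ℝ, 0 < C ∧ ∀ w ς δ ε : ℝ, 0 ≤ w → w ≤ 2 →
      0 < ς → 0 < δ → δ ≤ 1 / 2 → 0 < ε → ε ≤ 1 →
      horizontalMoves w t r₁ r₂ α rR β ς δ ε ≤ C * Real.log (1 / (δ * ε ^ ς)) := by
  have hl2 : 0 < Real.log 2 := Real.log_pos (by norm_num)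
  set D : ℝ → ℝ := fun x ↦ |Real.log (8 * x)| / Real.log 2 + 1 with hD
  have hD0 : ∀ x, 0 < D x := fun x ↦ by positivity
  have hDle : ∀ x L, Real.log 2 ≤ L → Real.log (8 * x) + L ≤ D x * L := fun x L hL ↦ by
    have h1 : |Real.log (8 * x)| ≤ |Real.log (8 * x)| / Real.log 2 * L := by
      rw [div_mul_eq_mul_div, le_div_iff₀ hl2]
      exact mul_le_mul_of_nonneg_left hL (abs_nonneg _)
    have h2 := le_abs_self (Real.log (8 * x))
    have h3 : D x * L = |Real.log (8 * x)| / Real.log 2 * L + L := by rw [hD]; ring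
    linarith
  have hDt := hD0 t
  have hDβ := hD0 β
  refine ⟨8 * D t / (r₂ * α) + 2 * D β / r₁ + D β / rR, by positivity, ?_⟩
  intro w ς δ ε hw hw2 hς hδ hδ2 hε hε1
  have he0 : 0 < ε ^ ς := Real.rpow_pos_of_pos hε ς
  have he1 : ε ^ ς ≤ 1 := Real.rpow_le_one hε.le hε1 hς.le
  set e := ε ^ ς
  set L := Real.log (1 / (δ * e)) with hL
  have hLeq : L = -Real.log δ - Real.log e := by
    rw [hL, one_div, Real.log_inv, Real.log_mul hδ.ne' he0.ne']
    ring
  have hδL : Real.log 2 ≤ -Real.log δ := by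
    rw [← Real.log_inv]
    exact Real.log_le_log (by norm_num) (by rw [le_inv_comm₀ (by norm_num) hδ]; linarith)
  have heL : Real.log e ≤ 0 := Real.log_nonpos he0.le he1
  have hL2 : Real.log 2 ≤ L := by linarith
  have hL0 : 0 < L := by linarith
  have h1 : Real.log (8 * t / (δ * e)) ≤ D t * L := by
    rw [Real.log_div (by positivity) (by positivity), Real.log_mul hδ.ne' he0.ne']
    have := hDle t L hL2
    linarith
  have h2 : Real.log (8 * β / δ) ≤ D β * L := by
    rw [Real.log_div (by positivity) hδ.ne']
    have := hDle β L hL2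
    linarith
  have e1 : 4 * w * Real.log (8 * t / (δ * e)) / (r₂ * α) ≤ 8 * D t / (r₂ * α) * L := by
    rw [div_mul_eq_mul_div]
    refine div_le_div_of_nonneg_right ?_ (by positivity)
    have h3 := mul_le_mul_of_nonneg_left h1 (by linarith : 0 ≤ 4 * w)
    have h4 := mul_le_mul_of_nonneg_right (by linarith : 4 * w ≤ 8) (mul_pos hDt hL0).le
    linarith
  have e2 : 2 * Real.log (8 * β / δ) / r₁ ≤ 2 * D β / r₁ * L := by
    rw [div_mul_eq_mul_div]
    exact div_le_div_of_nonneg_right (by linarith) hr₁.le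
  have e3 : Real.log (8 * β / δ) / rR ≤ D β / rR * L := by
    rw [div_mul_eq_mul_div]
    exact div_le_div_of_nonneg_right h2 hrR.le
  have p1 : 0 < 8 * D t / (r₂ * α) * L := by positivity
  have p2 : 0 < 2 * D β / r₁ * L := by positivity
  have p3 : 0 < D β / rR * L := by positivity
  rw [add_mul, add_mul]
  refine max_le ?_ (max_le ?_ ?_) <;> linarith

end MAPB

theorem mainTheorem3 (p η γ Δ : ℝ) (hη : 0 < η) (hη' : η < 1) (hp : 1 / 2 < p)
    (hp' : p < 1 - η / 2) (hγ : 0 < γ) (hΔ : 0 < Δ) :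
    (∃ r₁ r₂ α rR β₂ C : ℝ,
      0 < r₁ ∧ 0 < r₂ ∧ 0 < α ∧ 0 < rR ∧ 0 < β₂ ∧ 0 < C ∧
      ∀ ς : ℝ, 0 < ς → ς ≤ 1 →
        (∀ (θs : ℝ) (M : MAPB.AlignmentModel Δ θs) (δ ε : ℝ),
          0 < δ → δ < 1 → 0 < ε → M.PriorAssumption ς ε →
          M.ReachesPrecision p η γ δ ε
            (MAPB.horizontalMoves (max 1 (ς * (1 + ς))) 1 r₁ r₂ α rR β₂ ς δ ε)) ∧
        (∀ δ ε : ℝ, 0 < δ → δ ≤ 1 / 2 → 0 < ε → ε ≤ 1 →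
          MAPB.horizontalMoves (max 1 (ς * (1 + ς))) 1 r₁ r₂ α rR β₂ ς δ ε
            ≤ C * Real.log (1 / (δ * ε ^ ς)))) ∧
    (∃ r₁ r₂ rR : ℝ, 0 < r₁ ∧ 0 < r₂ ∧ 0 < rR ∧
      ∀ ς : ℝ, 0 < ς → ς ≤ 1 → ∃ α : ℝ, 0 < α ∧
      ∀ θs : ℝ, 0 < θs → ∃ β₂ C : ℝ, 0 < β₂ ∧ 0 < C ∧
        (∀ (M : MAPB.AlignmentModel Δ θs) (δ ε : ℝ),
          0 < δ → δ < 1 → 0 < ε → M.PriorAssumption ς ε →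
          M.ReachesPrecision p η γ δ ε
            (MAPB.horizontalMoves (ς * (1 + ς)) θs r₁ r₂ α rR β₂ ς δ ε)) ∧
        (∀ δ ε : ℝ, 0 < δ → δ ≤ 1 / 2 → 0 < ε → ε ≤ 1 →
          MAPB.horizontalMoves (ς * (1 + ς)) θs r₁ r₂ α rR β₂ ς δ ε
            ≤ C * Real.log (1 / (δ * ε ^ ς)))) := by

  constructor
  · obtain ⟨K, c, hK, hc, hrate⟩ := MAPB.exists_rate Δ hη hη' hp hp' hγ
    have hβ : 0 < (2 * K) ^ 2 / (8 * (8 * (1 : ℝ)) ^ 4) := by positivity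
    obtain ⟨C, hC, hCle⟩ := MAPB.horizontalMoves_le one_pos one_pos one_pos hc hc hβ
    refine ⟨1, 1, c, c, (2 * K) ^ 2 / (8 * (8 * 1) ^ 4), C, one_pos, one_pos, hc, hc, hβ, hC, ?_⟩
    intro ς hς hς1
    refine ⟨fun θs M δ ε hδ hδ1 hε hprior ↦ ?_, fun δ ε hδ hδ2 hε hε1 ↦
      hCle _ ς δ ε (zero_le_one.trans (le_max_left _ _)) (max_le one_le_two (by nlinarith))
        hς hδ hδ2 hε hε1⟩
    refine M.reachesPrecision_of_rate hK hc (hrate θs M ς ε hε hprior) one_pos hδ hδ1 hε rfl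
      fun he ↦ ?_
    -- the logarithm is nonnegative here, so a factor `w ≥ 1` does not decrease the threshold
    have he0 : 0 < ε ^ ς := Real.rpow_pos_of_pos hε ς
    have hlog : 0 ≤ Real.log (8 * 1 / (δ * ε ^ ς)) := by
      refine Real.log_nonneg ?_
      rw [one_le_div (by positivity)]
      nlinarith
    rw [one_mul]
    refine div_le_div_of_nonneg_right ?_ hc.le
    exact mul_le_mul_of_nonneg_right (by linarith [le_max_left 1 (ς * (1 + ς))]) hlog
  · obtain ⟨K, c, hK, hc, hrate⟩ := MAPB.exists_rate Δ hη hη' hp hp' hγ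
    refine ⟨1, 1, c, one_pos, one_pos, hc, fun ς hς hς1 ↦ ?_⟩
    have hw : 0 < ς * (1 + ς) := by positivity
    refine ⟨c * (ς * (1 + ς)), by positivity, fun θs hθs ↦ ?_⟩
    have hβ : 0 < (2 * K) ^ 2 / (8 * (8 * θs) ^ 4) := by positivity
    obtain ⟨C, hC, hCle⟩ := MAPB.horizontalMoves_le hθs one_pos one_pos
      (by positivity : 0 < c * (ς * (1 + ς))) hc hβ
    refine ⟨(2 * K) ^ 2 / (8 * (8 * θs) ^ 4), C, hβ, hC, fun M δ ε hδ hδ1 hε hprior ↦ ?_,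
      fun δ ε hδ hδ2 hε hε1 ↦ hCle _ ς δ ε hw.le (by nlinarith) hς hδ hδ2 hε hε1⟩
    refine M.reachesPrecision_of_rate hK hc (hrate θs M ς ε hε hprior) hθs hδ hδ1 hε rfl
      fun _ ↦ le_of_eq ?_
    field_simp
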